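/- Let $\theta>0$ and $d\in\mathbb N$. Let $(\overline X_{m,k})_{m,k\ge 1}$ be independent $\mathbb R^d$-valued random vectors, $\overline X_{m,k}=(X_{m,k,1},\dots,X_{m,k,d})$, such that $\overline X_{m,k}\stackrel{d}{=}\overline X_{m,1}$ for all $m,k\ge 1$. For each $n$ let $\sigma_n$ be a random permutation of $n$ points, independent of the family $(\overline X_{m,k})_{m,k\ge1}$, with the Ewens distribution of parameter $\theta$: $$\mathbb P[\sigma_n=s]=\frac{\theta^{\ell(s)}}{\theta(\theta+1)\cdots(\theta+n-1)}\qquad(s\in S_n),$$ where $\ell(s)$ is the total number of cycles of $s$ (fixed points included). Let $C_m=C_m^{(n)}$ be the number of cycles of length $m$ of $\sigma_n$ and put $$\overline A_n:=\sum_{m=1}^n\sum_{k=1}^{C_m}\overline X_{m,k}.$$ Assume that there are real constants $V_n$ with $V_n\to\infty$, real constants $\sigma_{j,\ell}$ ($1\le j,\ell\le d$), and $p>\max\{1/\theta,2\}$ such that $\mathbb E|X_{m,1,j}|^p<\infty$ for all $m\ge1$ and $1\le j\le d$, and, as $n\to\infty$, $$\frac1{V_n}\sum_{m=1}^n\frac1m\,\mathbb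 E\bigl[X_{m,1,j}X_{m,1,\ell}\bigr]\longrightarrow\sigma_{j,\ell}\quad(1\le j,\ell\le d),\qquad \sum_{m=1}^n\frac1m\,\mathbb E\bigl|X_{m,1,j}\bigr|^p=o\bigl(V_n^{p/2}\bigr)\quad(1\le j\le d).$$ Then the matrix $\Sigma=(\sigma_{j,\ell})_{1\le j,\ell\le d}$ is positive semidefinite, every $\overline A_n$ is integrable, and $$\frac{\overline A_n-\mathbb E\,\overline A_n}{\sqrt{\theta V_n}}$$ converges in distribution, as $n\to\infty$, to the (possibly degenerate) centred normal distribution $\mathcal N(0,\Sigma)$ on $\mathbb R^d$ with covariance matrix $\Sigma$. -/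

import Mathlib

open MeasureTheory ProbabilityTheory Filter Topology Asymptotics

namespace EwensCLT

/-- The finite set of permutations of `n` points carries the discrete σ-algebra. -/
instance permMeasurableSpace (n : ℕ) : MeasurableSpace (Equiv.Perm (Fin n)) := ⊤

/-- The number `C_m` of cycles of length `m` of a permutation of `n` points
(a fixed point is a cycle of length `1`). -/
def cycleCount {n : ℕ} (m : ℕ) (s : Equiv.Perm (Fin n)) : ℕ :=
  s.partition.parts.count m

/-- The total number of cycles of a permutation of `n` points, fixed points included. -/
def totalCycles {n : ℕ} (s : Equiv.Perm (Fin n)) : ℕ :=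
  s.partition.parts.card

/-- The Ewens probability of a permutation of `n` points:
`θ ^ (number of cycles) / (θ (θ + 1) ⋯ (θ + n - 1))`. -/
noncomputable def ewensWeight (θ : ℝ) {n : ℕ} (s : Equiv.Perm (Fin n)) : ℝ :=
  θ ^ totalCycles s / ∏ i ∈ Finset.range n, (θ + i)

/-- The random permutation `τ` of `n` points has the Ewens distribution with parameter `θ`. -/
structure IsEwens {Ω : Type*} [MeasurableSpace Ω] (P : Measure Ω) (θ : ℝ) {n : ℕ}
    (τ : Ω → Equiv.Perm (Fin n)) : Prop where
  measurable : Measurable τ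
  prob_eq : ∀ s : Equiv.Perm (Fin n), P (τ ⁻¹' {s}) = ENNReal.ofReal (ewensWeight θ s)

/-- The random sum `A_n = ∑_{m=1}^n ∑_{k=1}^{C_m} X_{m,k}`, where `C_m` is the number of
cycles of length `m` of the random permutation `τ` of `n` points. -/
noncomputable def cycleSum {Ω : Type*} {d n : ℕ} (τ : Ω → Equiv.Perm (Fin n))
    (X : ℕ → ℕ → Ω → EuclideanSpace ℝ (Fin d)) (ω : Ω) : EuclideanSpace ℝ (Fin d) :=
  ∑ m ∈ Finset.Icc 1 n, ∑ k ∈ Finset.Icc 1 (cycleCount m (τ ω)), X m k ω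

end EwensCLT

/-! Fix `t` and write `Y_m = ⟨t, X_{m,1}⟩`, `c_n = (θ V_n)^(-1/2)` and `ψ_m = E exp(i c_n Y_m)`.
Conditioning on the permutation gives `E exp(i c_n ⟨t, A_n⟩) = E ∏_m ψ_m ^ C_m`, which is `ewensGen
θ ψ n`. If the `C_m` were independent Poisson variables with parameters `θ/m`, this would be
`exp(∑_{m≤n} (θ/m)(ψ_m - 1))`, and a second order expansion of `ψ_m` would give the Gaussian limit.
The work lies in replacing the true cycle counts by Poisson ones.

The comparison is the Feller coupling, carried out on generating functions and without constructing
it. Counting permutations by cycle type yields the renewal equation `G_n = ∑_m q(n,m) ψ_m G_{n-m}`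
(`ewensGen_eq_sum`), where `q(n,m)` is the law of the last cycle. Leaving out the factor of that
cycle gives `M_n = ∑_m q(n,m) G_{n-m}`, and `M_{n+1} - M_n = θ/(θ+n) (G_n - M_n)`. Since `|G_n -
M_n| ≤ ∑_m q(n,m) |ψ_m - 1|`, telescoping `M` from `n` to `N` bounds `|G_N - G_n|` uniformly in `N`.
If `ψ_m = 1` for `m > n`, then `G_N` tends to the Poisson expression as `N → ∞`
(`tendsto_ewensGen`). Hence `norm_ewensGen_sub_exp_le`: the error is at most a constant times `∑_m
w(n,m) |ψ_m - 1|`, with `w(n,m) = n^(-α) (n-m+1)^(α-1)` and `α = min θ 1`. The same telescoping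
bounds `|E C_m - θ/m|` by a multiple of `w(n,m)`, which controls the centring.

Now `|ψ_m - 1| ≤ c_n E|Y_m|`, and Hölder's inequality bounds `∑_m w(n,m) E|Y_m|` by `K (∑_m E|Y_m|^p
/ m)^(1/p)` (`exists_sum_couplingWeight_le`). This is where `p > 1/θ` enters: `w(n,·)` has to lie in
the dual Lebesgue space in spite of its growth near `m = n` when `θ < 1`. The moment hypothesis
makes both errors vanish, and it also makes the Taylor remainder negligible, as in Lyapunov's
theorem. Lévy's continuity theorem concludes. -/

namespace EwensCLT

/-! ### Sums over permutations and partitions -/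

/-- The order of the centralizer of a permutation whose cycle lengths, fixed points included, are
the elements of `s`. -/
def centralizerCard (s : Multiset ℕ) : ℕ := s.prod * ∏ i ∈ s.toFinset, (s.count i).factorial

lemma centralizerCard_cons (m : ℕ) (s : Multiset ℕ) :
    centralizerCard (m ::ₘ s) = m * (s.count m + 1) * centralizerCard s := by
  have h1 : ∏ i ∈ s.toFinset, (s.count i).factorial
      = ∏ i ∈ insert m s.toFinset, (s.count i).factorial := by
    refine Finset.prod_subset (Finset.subset_insert _ _) fun i _ hi ↦ ?_
    rw [Multiset.count_eq_zero_of_notMem (by simpa using hi), Nat.factorial_zero]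
  have h2 : ∏ i ∈ (insert m s.toFinset).erase m, ((m ::ₘ s).count i).factorial
      = ∏ i ∈ (insert m s.toFinset).erase m, (s.count i).factorial :=
    Finset.prod_congr rfl fun i hi ↦ by
      rw [Multiset.count_cons_of_ne (Finset.ne_of_mem_erase hi)]
  rw [centralizerCard, centralizerCard, Multiset.toFinset_cons, Multiset.prod_cons, h1,
    ← Finset.mul_prod_erase _ _ (Finset.mem_insert_self m s.toFinset), h2,
    ← Finset.mul_prod_erase _ _ (Finset.mem_insert_self m s.toFinset), Multiset.count_cons_self,
    Nat.factorial_succ]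
  ring

lemma centralizerCard_add_replicate {s : Multiset ℕ} (hs : s.count 1 = 0) (k : ℕ) :
    centralizerCard (s + Multiset.replicate k 1) = k.factorial * centralizerCard s := by
  induction k with
  | zero => simp
  | succ k ih =>
    rw [Multiset.replicate_succ, Multiset.add_cons, centralizerCard_cons, ih, Multiset.count_add,
      hs, Multiset.count_replicate_self, Nat.factorial_succ]
    ring

lemma centralizerCard_pos {s : Multiset ℕ} (hs : ∀ i ∈ s, 0 < i) : 0 < centralizerCard s :=
  Nat.mul_pos (Multiset.prod_pos hs) (Finset.prod_pos fun _ _ ↦ Nat.factorial_pos _)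

lemma parts_eq_filter_add_replicate {n : ℕ} (p : n.Partition) :
    p.parts = p.parts.filter (2 ≤ ·)
      + Multiset.replicate (n - (p.parts.filter (2 ≤ ·)).sum) 1 := by
  have h1 : p.parts.filter (fun i ↦ ¬ 2 ≤ i)
      = Multiset.replicate (p.parts.filter (fun i ↦ ¬ 2 ≤ i)).card 1 := by
    refine Multiset.eq_replicate_card.2 fun i hi ↦ ?_
    have := p.parts_pos (Multiset.mem_of_mem_filter hi)
    have := Multiset.of_mem_filter hi
    omega
  have h2 := Multiset.filter_add_not (2 ≤ ·) p.parts
  have h3 := congrArg Multiset.sum h2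
  rw [Multiset.sum_add, h1, Multiset.sum_replicate, p.parts_sum, smul_eq_mul, mul_one] at h3
  conv_lhs => rw [← h2, h1]
  congr 2
  omega

/-- Orbit counting for a conjugacy class. The Mathlib count is indexed by cycle types, which omit
fixed points; a part `1` of multiplicity `k` contributes `1 ^ k * k!` to the centralizer, which is
exactly the extra factorial in that count. -/
lemma card_filter_parts_eq {n : ℕ} (p : n.Partition) :
    (Finset.univ.filter fun s : Equiv.Perm (Fin n) ↦ s.partition.parts = p.parts).card
      * centralizerCard p.parts = n.factorial := by
  have hle : (p.parts.filter (2 ≤ ·)).sum ≤ n := by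
    have h := congrArg Multiset.sum (Multiset.filter_add_not (2 ≤ ·) p.parts)
    rw [Multiset.sum_add, p.parts_sum] at h
    omega
  have h1 : (Finset.univ.filter fun s : Equiv.Perm (Fin n) ↦ s.partition.parts = p.parts)
      = Finset.univ.filter fun s ↦ s.cycleType = p.parts.filter (2 ≤ ·) := by
    ext s
    simp only [Finset.mem_filter, Finset.mem_univ, true_and]
    constructor
    · intro h
      rw [← h]
      exact (Equiv.Perm.filter_parts_partition_eq_cycleType).symm
    · intro h
      rw [Equiv.Perm.parts_partition, parts_eq_filter_add_replicate p, ← h,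
        ← Equiv.Perm.sum_cycleType, Fintype.card_fin]
  have h2 := Equiv.Perm.card_of_cycleType_mul_eq (Fin n) (p.parts.filter (2 ≤ ·))
  rw [if_pos ⟨by simpa using hle, fun a ha ↦ Multiset.of_mem_filter ha⟩, Fintype.card_fin] at h2
  rw [h1, ← h2, parts_eq_filter_add_replicate p, centralizerCard_add_replicate (by simp),
    ← parts_eq_filter_add_replicate p, centralizerCard]
  ring

/-- The average of `F` over the cycle types of the permutations of `n` points. -/
noncomputable def cycleAverage (n : ℕ) (F : Multiset ℕ → ℂ) : ℂ :=
  ∑ p : n.Partition, F p.parts / centralizerCard p.parts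

lemma sum_perm_eq_cycleAverage (n : ℕ) (F : Multiset ℕ → ℂ) :
    ∑ s : Equiv.Perm (Fin n), F s.partition.parts = n.factorial * cycleAverage n F := by
  classical
  -- `s.partition` is a partition of `Fintype.card (Fin n)`; here it is transported to a partition
  -- of `n`.
  let f : Equiv.Perm (Fin n) → n.Partition := fun s ↦
    ⟨s.partition.parts, s.partition.parts_pos, by rw [s.partition.parts_sum, Fintype.card_fin]⟩
  rw [← Finset.sum_fiberwise (s := Finset.univ) (g := f), cycleAverage, Finset.mul_sum]
  refine Finset.sum_congr rfl fun p _ ↦ ?_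
  have hf : ∀ s, f s = p ↔ s.partition.parts = p.parts := fun s ↦ Nat.Partition.ext_iff
  rw [Finset.sum_congr rfl (g := fun _ ↦ F p.parts)
    (fun s hs ↦ by rw [(hf s).1 (Finset.mem_filter.1 hs).2]), Finset.sum_const, nsmul_eq_mul]
  simp_rw [hf]
  have hz : (centralizerCard p.parts : ℂ) ≠ 0 :=
    Nat.cast_ne_zero.2 (centralizerCard_pos fun i hi ↦ p.parts_pos hi).ne'
  rw [← card_filter_parts_eq p]
  push_cast
  field_simp

/-- Removing one part `m` is a bijection from the partitions of `n` that contain `m` onto the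
partitions of `n - m`. It divides the order of the centralizer by `m` times the multiplicity of `m`,
and the multiplicity cancels against the factor `count m`. Every recursion, derivative and mean
below comes from this identity. -/
lemma cycleAverage_count_mul {n m : ℕ} (hm : 1 ≤ m) (hmn : m ≤ n) (F : Multiset ℕ → ℂ) :
    cycleAverage n (fun s ↦ s.count m * F (s.erase m)) = (1 / m) * cycleAverage (n - m) F := by
  classical
  have h0 : cycleAverage n (fun s ↦ s.count m * F (s.erase m))
      = ∑ p : {p : n.Partition // m ∈ p.parts},
        (p.1.parts.count m * F (p.1.parts.erase m)) / centralizerCard p.1.parts := by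
    rw [cycleAverage, ← Finset.sum_subtype (Finset.univ.filter fun p : n.Partition ↦ m ∈ p.parts)
      (by simp) (fun p : n.Partition ↦
        (p.parts.count m * F (p.parts.erase m)) / (centralizerCard p.parts : ℂ))]
    refine (Finset.sum_subset (Finset.filter_subset _ _) fun p _ hp ↦ ?_).symm
    rw [Multiset.count_eq_zero_of_notMem (by simpa using hp)]
    simp
  rw [h0, ← Equiv.sum_comp (Nat.Partition.partitionWithPartEquiv hm hmn).symm, cycleAverage,
    Finset.mul_sum]
  refine Finset.sum_congr rfl fun p _ ↦ ?_
  rw [Nat.Partition.partitionWithPartEquiv_symm_apply_parts, Multiset.erase_cons_head,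
    Multiset.count_cons_self, centralizerCard_cons]
  have hz : (centralizerCard p.parts : ℂ) ≠ 0 :=
    Nat.cast_ne_zero.2 (centralizerCard_pos fun i hi ↦ p.parts_pos hi).ne'
  have hm' : (m : ℂ) ≠ 0 := Nat.cast_ne_zero.2 (by omega)
  have hc : (p.parts.count m + 1 : ℂ) ≠ 0 := Nat.cast_add_one_ne_zero _
  push_cast
  field_simp

lemma sum_map_parts {n : ℕ} (p : n.Partition) (f : ℕ → ℂ) :
    (p.parts.map f).sum = ∑ m ∈ Finset.Icc 1 n, p.parts.count m * f m := by
  rw [Finset.sum_multiset_map_count]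
  simp_rw [nsmul_eq_mul]
  refine Finset.sum_subset (fun i hi ↦ ?_) fun i _ hi ↦ ?_
  · have hi' := Multiset.mem_toFinset.1 hi
    exact Finset.mem_Icc.2 ⟨p.parts_pos hi', p.le_of_mem_parts hi'⟩
  · rw [Multiset.count_eq_zero_of_notMem (by simpa using hi)]
    simp

/-- The average over the permutations of `n` points of the product over the cycles of the weight
`x m`, with `m` the length of the cycle. -/
noncomputable def cyclePoly (n : ℕ) (x : ℕ → ℂ) : ℂ :=
  cycleAverage n fun s ↦ (s.map x).prod

lemma cycleAverage_sum {ι : Type*} (n : ℕ) (t : Finset ι) (F : ι → Multiset ℕ → ℂ) :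
    cycleAverage n (fun s ↦ ∑ i ∈ t, F i s) = ∑ i ∈ t, cycleAverage n (F i) := by
  simp_rw [cycleAverage, Finset.sum_div]
  exact Finset.sum_comm

lemma cycleAverage_mul_left (n : ℕ) (c : ℂ) (F : Multiset ℕ → ℂ) :
    cycleAverage n (fun s ↦ c * F s) = c * cycleAverage n F := by
  simp_rw [cycleAverage, Finset.mul_sum, mul_div_assoc]

lemma cycleAverage_congr {n : ℕ} {F G : Multiset ℕ → ℂ}
    (h : ∀ p : n.Partition, F p.parts = G p.parts) : cycleAverage n F = cycleAverage n G :=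
  Finset.sum_congr rfl fun p _ ↦ by rw [h p]

lemma cycleAverage_sum_map (n : ℕ) (f : ℕ → ℂ) (x : ℕ → ℂ) :
    cycleAverage n (fun s ↦ (s.map fun i ↦ f i * ((s.erase i).map x).prod).sum)
      = ∑ m ∈ Finset.Icc 1 n, f m / m * cyclePoly (n - m) x := by
  rw [cycleAverage_congr (G := fun s ↦ ∑ m ∈ Finset.Icc 1 n,
    f m * (s.count m * ((s.erase m).map x).prod)) fun p ↦ ?_, cycleAverage_sum]
  · refine Finset.sum_congr rfl fun m hm ↦ ?_
    obtain ⟨h1, h2⟩ := Finset.mem_Icc.1 hm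
    rw [cycleAverage_mul_left, cycleAverage_count_mul h1 h2 fun s ↦ (s.map x).prod, cyclePoly]
    ring
  · rw [sum_map_parts]
    exact Finset.sum_congr rfl fun m _ ↦ by ring

/-- Write `n` as the sum of the parts and remove a marked part. This is the coefficient form of `z
F' = (∑ x_m z^m) F` for `F = exp(∑ x_m z^m / m)`. -/
lemma natCast_mul_cyclePoly (n : ℕ) (x : ℕ → ℂ) :
    n * cyclePoly n x = ∑ m ∈ Finset.Icc 1 n, x m * cyclePoly (n - m) x := by
  rw [cyclePoly, ← cycleAverage_mul_left, cycleAverage_congr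
    (G := fun s ↦ (s.map fun i : ℕ ↦ ((i : ℂ) * x i) * ((s.erase i).map x).prod).sum) fun p ↦ ?_,
    cycleAverage_sum_map]
  · refine Finset.sum_congr rfl fun m hm ↦ ?_
    have hm' : (m : ℂ) ≠ 0 := Nat.cast_ne_zero.2 (by have := (Finset.mem_Icc.1 hm).1; omega)
    field_simp
  · have h : (p.parts.map fun i : ℕ ↦ ((i : ℂ) * x i) * ((p.parts.erase i).map x).prod)
        = p.parts.map fun i : ℕ ↦ (i : ℂ) * (p.parts.map x).prod :=
      Multiset.map_congr rfl fun i hi ↦ by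
        rw [← Multiset.prod_map_erase (f := x) hi]; ring
    rw [h, Multiset.sum_map_mul_right]
    congr 1
    have := congrArg (Nat.cast : ℕ → ℂ) p.parts_sum
    rw [← this]
    simp

lemma cyclePoly_zero (x : ℕ → ℂ) : cyclePoly 0 x = 1 := by
  simp [cyclePoly, cycleAverage, centralizerCard]

lemma hasDerivAt_multiset_map_prod {f : ℕ → ℝ → ℂ} {f' : ℕ → ℂ} {u : ℝ}
    (hf : ∀ i, HasDerivAt (f i) (f' i) u) (s : Multiset ℕ) :
    HasDerivAt (fun v ↦ (s.map fun i ↦ f i v).prod)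
      (s.map fun i ↦ f' i * ((s.erase i).map fun j ↦ f j u).prod).sum u := by
  induction s using Multiset.induction_on with
  | empty => simpa using hasDerivAt_const u (1 : ℂ)
  | cons a s ih =>
    simp only [Multiset.map_cons, Multiset.prod_cons, Multiset.sum_cons, Multiset.erase_cons_head]
    refine ((hf a).mul ih).congr_deriv ?_
    congr 1
    rw [← Multiset.sum_map_mul_left]
    refine congrArg _ (Multiset.map_congr rfl fun i hi ↦ ?_)
    rw [Multiset.erase_cons_tail_of_mem hi, Multiset.map_cons, Multiset.prod_cons]
    ring

lemma hasDerivAt_cyclePoly (n : ℕ) {f : ℕ → ℝ → ℂ} {f' : ℕ → ℂ} {u : ℝ}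
    (hf : ∀ i, HasDerivAt (f i) (f' i) u) :
    HasDerivAt (fun v ↦ cyclePoly n fun i ↦ f i v)
      (∑ m ∈ Finset.Icc 1 n, f' m / m * cyclePoly (n - m) fun i ↦ f i u) u := by
  rw [← cycleAverage_sum_map]
  simp only [cyclePoly, cycleAverage]
  exact HasDerivAt.fun_sum fun (p : n.Partition) _ ↦ (hasDerivAt_multiset_map_prod hf p.parts).div_const _

end EwensCLT

namespace EwensCLT

/-! ### The renewal recursion of the Feller coupling -/

/-- The coefficients `θ (θ + 1) ⋯ (θ + n - 1) / n!` of `(1 - z) ^ (-θ)`. -/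
noncomputable def risingCoeff (θ : ℝ) (n : ℕ) : ℝ :=
  (∏ i ∈ Finset.range n, (θ + i)) / n.factorial

lemma risingCoeff_zero (θ : ℝ) : risingCoeff θ 0 = 1 := by simp [risingCoeff]

lemma risingCoeff_succ (θ : ℝ) (n : ℕ) :
    risingCoeff θ (n + 1) = risingCoeff θ n * ((θ + n) / (n + 1)) := by
  have h : (n.factorial : ℝ) ≠ 0 := Nat.cast_ne_zero.2 n.factorial_ne_zero
  rw [risingCoeff, risingCoeff, Finset.prod_range_succ, Nat.factorial_succ]
  push_cast
  field_simp

lemma risingCoeff_pos {θ : ℝ} (hθ : 0 < θ) (n : ℕ) : 0 < risingCoeff θ n :=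
  div_pos (Finset.prod_pos fun _ _ ↦ by positivity) (by positivity)

lemma mul_sum_risingCoeff (θ : ℝ) (n : ℕ) :
    θ * ∑ j ∈ Finset.range n, risingCoeff θ j = n * risingCoeff θ n := by
  induction n with
  | zero => simp
  | succ n ih =>
    have h : (n + 1 : ℝ) ≠ 0 := by positivity
    rw [Finset.sum_range_succ, mul_add, ih, risingCoeff_succ]
    push_cast
    field_simp
    ring

lemma sum_Icc_sub {E : Type*} [AddCommMonoid E] (n : ℕ) (f : ℕ → E) :
    ∑ m ∈ Finset.Icc 1 n, f (n - m) = ∑ j ∈ Finset.range n, f j := by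
  refine Finset.sum_bij' (fun m _ ↦ n - m) (fun j _ ↦ n - j) ?_ ?_ ?_ ?_ ?_ <;>
    simp only [Finset.mem_Icc, Finset.mem_range] <;> intros <;> first | omega | trivial

lemma cyclePoly_const (θ : ℝ) (n : ℕ) : cyclePoly n (fun _ ↦ (θ : ℂ)) = risingCoeff θ n := by
  induction n using Nat.strong_induction_on with
  | _ n ih =>
    rcases Nat.eq_zero_or_pos n with rfl | hn
    · simp [cyclePoly_zero, risingCoeff_zero]
    · have hn' : (n : ℂ) ≠ 0 := Nat.cast_ne_zero.2 hn.ne'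
      refine mul_left_cancel₀ hn' ?_
      rw [natCast_mul_cyclePoly]
      have h := congrArg (Complex.ofReal) (mul_sum_risingCoeff θ n)
      push_cast at h
      rw [← h, ← sum_Icc_sub n (fun j ↦ (risingCoeff θ j : ℂ)), Finset.mul_sum]
      refine Finset.sum_congr rfl fun m hm ↦ ?_
      rw [ih _ (by have := Finset.mem_Icc.1 hm; omega)]

/-- The probability that the last cycle of the Feller coupling of size `n` has length `m`. -/
noncomputable def lastCycleProb (θ : ℝ) (n m : ℕ) : ℝ :=
  θ / n * (risingCoeff θ (n - m) / risingCoeff θ n)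

lemma lastCycleProb_nonneg {θ : ℝ} (hθ : 0 < θ) (n m : ℕ) : 0 ≤ lastCycleProb θ n m := by
  have h1 := risingCoeff_pos hθ (n - m)
  have h2 := risingCoeff_pos hθ n
  unfold lastCycleProb
  positivity

lemma sum_lastCycleProb {θ : ℝ} (hθ : 0 < θ) {n : ℕ} (hn : 1 ≤ n) :
    ∑ m ∈ Finset.Icc 1 n, lastCycleProb θ n m = 1 := by
  have h := risingCoeff_pos hθ n
  have hn' : (0 : ℝ) < n := by exact_mod_cast hn
  simp_rw [lastCycleProb]
  rw [sum_Icc_sub n fun j ↦ θ / n * (risingCoeff θ j / risingCoeff θ n), ← Finset.mul_sum,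
    ← Finset.sum_div, div_mul_div_comm, mul_sum_risingCoeff, div_self (by positivity)]

lemma lastCycleProb_succ_one {θ : ℝ} (hθ : 0 < θ) (n : ℕ) :
    lastCycleProb θ (n + 1) 1 = θ / (θ + n) := by
  have h := risingCoeff_pos hθ n
  have h2 : (0 : ℝ) < θ + n := by positivity
  have h3 : (0 : ℝ) < n + 1 := by positivity
  rw [lastCycleProb, risingCoeff_succ, Nat.add_sub_cancel]
  push_cast
  field_simp

lemma lastCycleProb_succ_succ {θ : ℝ} (hθ : 0 < θ) {n : ℕ} (hn : 1 ≤ n) (m : ℕ) :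
    lastCycleProb θ (n + 1) (m + 1) = n / (θ + n) * lastCycleProb θ n m := by
  have h := risingCoeff_pos hθ n
  have h2 : (0 : ℝ) < θ + n := by positivity
  have h3 : (0 : ℝ) < n + 1 := by positivity
  have h4 : (0 : ℝ) < n := by exact_mod_cast hn
  rw [lastCycleProb, lastCycleProb, risingCoeff_succ, Nat.add_sub_add_right]
  push_cast
  field_simp

/-- The expectation of `∏_m ψ_m ^ C_m` under the Ewens distribution. -/
noncomputable def ewensGen (θ : ℝ) (ψ : ℕ → ℂ) (n : ℕ) : ℂ :=
  cyclePoly n (fun m ↦ θ * ψ m) / risingCoeff θ n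

/-- The expectation of the product of `ψ` over the completed cycles in the Feller coupling. -/
noncomputable def ewensGenCompleted (θ : ℝ) (ψ : ℕ → ℂ) (n : ℕ) : ℂ :=
  ∑ m ∈ Finset.Icc 1 n, lastCycleProb θ n m * ewensGen θ ψ (n - m)

lemma ewensGen_zero (θ : ℝ) (ψ : ℕ → ℂ) : ewensGen θ ψ 0 = 1 := by
  simp [ewensGen, cyclePoly_zero, risingCoeff_zero]

lemma ewensGen_eq_sum {θ : ℝ} (hθ : 0 < θ) (ψ : ℕ → ℂ) {n : ℕ} (hn : 1 ≤ n) :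
    ewensGen θ ψ n
      = ∑ m ∈ Finset.Icc 1 n, lastCycleProb θ n m * (ψ m * ewensGen θ ψ (n - m)) := by
  have hn' : (n : ℂ) ≠ 0 := Nat.cast_ne_zero.2 (by omega)
  have hd : ∀ k, (risingCoeff θ k : ℂ) ≠ 0 := fun k ↦
    Complex.ofReal_ne_zero.2 (risingCoeff_pos hθ k).ne'
  have h := natCast_mul_cyclePoly n fun m ↦ (θ : ℂ) * ψ m
  rw [ewensGen, div_eq_iff (hd n), ← mul_right_inj' hn', h, Finset.sum_mul, Finset.mul_sum]
  refine Finset.sum_congr rfl fun m _ ↦ ?_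
  have h1 := hd n
  have h2 := hd (n - m)
  rw [lastCycleProb, ewensGen]
  push_cast
  field_simp

lemma norm_ewensGen_le_one {θ : ℝ} (hθ : 0 < θ) {ψ : ℕ → ℂ} (hψ : ∀ m, ‖ψ m‖ ≤ 1) (n : ℕ) :
    ‖ewensGen θ ψ n‖ ≤ 1 := by
  induction n using Nat.strong_induction_on with
  | _ n ih =>
    rcases Nat.eq_zero_or_pos n with rfl | hn
    · simp [ewensGen_zero]
    · rw [ewensGen_eq_sum hθ ψ hn, ← sum_lastCycleProb hθ hn]
      refine norm_sum_le_of_le _ fun m hm ↦ ?_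
      rw [norm_mul, norm_mul, Complex.norm_real, Real.norm_of_nonneg (lastCycleProb_nonneg hθ n m)]
      refine mul_le_of_le_one_right (lastCycleProb_nonneg hθ n m) ?_
      exact mul_le_one₀ (hψ m) (norm_nonneg _) (ih _ (by have := Finset.mem_Icc.1 hm; omega))

/-- The two sums differ only by the factor `ψ m` of the last cycle; all other factors have modulus
at most one. -/
lemma norm_ewensGen_sub_completed_le {θ : ℝ} (hθ : 0 < θ) {ψ : ℕ → ℂ} (hψ : ∀ m, ‖ψ m‖ ≤ 1)
    {n : ℕ} (hn : 1 ≤ n) :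
    ‖ewensGen θ ψ n - ewensGenCompleted θ ψ n‖
      ≤ ∑ m ∈ Finset.Icc 1 n, lastCycleProb θ n m * ‖ψ m - 1‖ := by
  rw [ewensGen_eq_sum hθ ψ hn, ewensGenCompleted, ← Finset.sum_sub_distrib]
  refine norm_sum_le_of_le _ fun m hm ↦ ?_
  rw [← mul_sub, norm_mul, Complex.norm_real, Real.norm_of_nonneg (lastCycleProb_nonneg hθ n m),
    ← sub_one_mul, norm_mul]
  exact mul_le_mul_of_nonneg_left (mul_le_of_le_one_right (norm_nonneg _)
    (norm_ewensGen_le_one hθ hψ _)) (lastCycleProb_nonneg hθ n m)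

/-- One step of the Feller coupling: with probability `θ / (θ + n)` the open cycle is closed, so
that all cycles of size `n` are completed; otherwise it grows by one and the completed cycles do not
change. -/
lemma ewensGenCompleted_succ {θ : ℝ} (hθ : 0 < θ) (ψ : ℕ → ℂ) {n : ℕ} (hn : 1 ≤ n) :
    ewensGenCompleted θ ψ (n + 1) - ewensGenCompleted θ ψ n
      = (θ / (θ + n) : ℝ) * (ewensGen θ ψ n - ewensGenCompleted θ ψ n) := by
  have h : ewensGenCompleted θ ψ (n + 1) = (θ / (θ + n) : ℝ) * ewensGen θ ψ n
      + (n / (θ + n) : ℝ) * ewensGenCompleted θ ψ n := by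
    have hI : Finset.Icc 1 (n + 1) = insert 1 ((Finset.Icc 1 n).map (addRightEmbedding 1)) := by
      ext i
      simp only [Finset.mem_insert, Finset.mem_map, Finset.mem_Icc, addRightEmbedding_apply]
      constructor
      · rintro ⟨h1, h2⟩
        rcases Nat.eq_or_lt_of_le h1 with h | h
        · exact Or.inl h.symm
        · exact Or.inr ⟨i - 1, by omega, by omega⟩
      · rintro (rfl | ⟨j, hj, rfl⟩) <;> omega
    rw [ewensGenCompleted, hI, Finset.sum_insert (by simp), Finset.sum_map,
      lastCycleProb_succ_one hθ, ewensGenCompleted, Finset.mul_sum]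
    congr 1
    refine Finset.sum_congr rfl fun m _ ↦ ?_
    rw [addRightEmbedding_apply, lastCycleProb_succ_succ hθ hn, Nat.add_sub_add_right]
    push_cast
    ring
  have h2 : (θ + n : ℂ) ≠ 0 := by
    have : (θ + n : ℝ) ≠ 0 := by positivity
    exact_mod_cast this
  rw [h]
  push_cast
  field_simp
  ring

/-- A sequence obeying the renewal recursion up to errors `δ` is Cauchy. -/
lemma norm_sub_le_of_renewal {E : Type*} [NormedAddCommGroup E] {θ : ℝ} (hθ : 0 < θ)
    {G M : ℕ → E} {δ : ℕ → ℝ} {n N : ℕ} (hnN : n ≤ N)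
    (h1 : ∀ k, n ≤ k → ‖G k - M k‖ ≤ δ k)
    (h2 : ∀ k, n ≤ k → ‖M (k + 1) - M k‖ ≤ θ / (θ + k) * ‖G k - M k‖) :
    ‖G N - G n‖ ≤ δ n + δ N + ∑ k ∈ Finset.Ico n N, θ / (θ + k) * δ k := by
  have h3 : ‖M N - M n‖ ≤ ∑ k ∈ Finset.Ico n N, θ / (θ + k) * δ k := by
    rw [← Finset.sum_Ico_sub M hnN]
    refine norm_sum_le_of_le _ fun k hk ↦ ?_
    have hk' := (Finset.mem_Ico.1 hk).1
    exact (h2 k hk').trans (mul_le_mul_of_nonneg_left (h1 k hk') (by positivity))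
  -- Only `M` has small increments, so the path goes from `G n` to `M n`, along `M` to `M N`, and
  -- back to `G N`.
  calc ‖G N - G n‖ = ‖(G N - M N) + (M N - M n) - (G n - M n)‖ := by congr 1; abel
    _ ≤ ‖G N - M N‖ + ‖M N - M n‖ + ‖G n - M n‖ :=
      (norm_sub_le _ _).trans (add_le_add_left (norm_add_le _ _) _)
    _ ≤ _ := by linarith [h1 n le_rfl, h1 N hnN]

end EwensCLT

namespace EwensCLT

/-! ### Power bounds for the renewal weights -/

/-- Bernoulli's inequality for exponents in `[0, 1]`, applied to `(1 - 1/y) ^ a`. -/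
lemma rpow_sub_one_le {a y : ℝ} (ha0 : 0 ≤ a) (ha1 : a ≤ 1) (hy : 1 ≤ y) :
    (y - 1) ^ a ≤ y ^ a * (1 - a / y) := by
  have hy0 : 0 < y := by linarith
  have h1 : -1 ≤ -(1 / y) := by
    rw [neg_le_neg_iff, div_le_one hy0]
    exact hy
  have h2 := rpow_one_add_le_one_add_mul_self h1 ha0 ha1
  have h3 : y - 1 = y * (1 + -(1 / y)) := by field_simp; ring
  rw [h3, Real.mul_rpow hy0.le (by linarith)]
  refine mul_le_mul_of_nonneg_left (h2.trans (le_of_eq ?_)) (by positivity)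
  ring

lemma sum_rpow_neg_le {s : ℝ} (hs0 : 0 ≤ s) (hs1 : s < 1) (n : ℕ) :
    ∑ j ∈ Finset.range n, ((j : ℝ) + 1) ^ (-s) ≤ (n : ℝ) ^ (1 - s) / (1 - s) := by
  have hs : 0 < 1 - s := by linarith
  induction n with
  | zero => simp [Real.zero_rpow hs.ne']
  | succ n ih =>
    rw [Finset.sum_range_succ]
    have hn : (0 : ℝ) < n + 1 := by positivity
    have h := rpow_sub_one_le hs.le (by linarith) (show (1 : ℝ) ≤ n + 1 by simp)
    have h2 : ((n : ℝ) + 1) ^ (1 - s) = (n + 1) ^ (-s) * (n + 1) := by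
      rw [← Real.rpow_add_one hn.ne']
      congr 1
      ring
    rw [add_sub_cancel_right] at h
    push_cast
    rw [le_div_iff₀ hs] at ih ⊢
    have h3 : ((n : ℝ) + 1) ^ (1 - s) * (1 - (1 - s) / (n + 1))
        = (n + 1) ^ (1 - s) - (n + 1) ^ (-s) * (1 - s) := by
      rw [h2]
      field_simp
    nlinarith

lemma sum_rpow_neg_one_sub_le {α : ℝ} (h0 : 0 < α) (h1 : α ≤ 1) {n N : ℕ} (hn : 1 ≤ n)
    (hnN : n ≤ N) :
    ∑ k ∈ Finset.Ico n N, (k : ℝ) ^ (-1 - α) ≤ 2 / α * (n : ℝ) ^ (-α) := by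
  -- The telescoping form is the one that closes under induction; the factor `2` absorbs `k + 1 ≤ 2
  -- k`.
  suffices h : ∑ k ∈ Finset.Ico n N, (k : ℝ) ^ (-1 - α)
      ≤ 2 / α * ((n : ℝ) ^ (-α) - (N : ℝ) ^ (-α)) by
    refine h.trans (mul_le_mul_of_nonneg_left ?_ (by positivity))
    have : (0 : ℝ) ≤ (N : ℝ) ^ (-α) := by positivity
    linarith
  induction N, hnN using Nat.le_induction with
  | base => simp
  | succ k hk ih =>
    rw [Finset.sum_Ico_succ_top hk]
    have hk0 : (1 : ℝ) ≤ k := by exact_mod_cast hn.trans hk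
    have hk1 : (0 : ℝ) < k := by linarith
    have hk2 : (0 : ℝ) < k + 1 := by linarith
    have h := rpow_sub_one_le h0.le h1 (show (1 : ℝ) ≤ k + 1 by linarith)
    rw [add_sub_cancel_right] at h
    have h2 : ((k : ℝ) + 1) ^ (-α) ≤ (k : ℝ) ^ (-α) * (1 - α / (k + 1)) := by
      rw [Real.rpow_neg hk2.le, Real.rpow_neg hk1.le, inv_mul_eq_div,
        le_div_iff₀ (by positivity), inv_mul_le_iff₀ (by positivity)]
      exact h
    have h3 : (k : ℝ) ^ (-1 - α) = (k : ℝ) ^ (-α) / k := by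
      rw [← Real.rpow_sub_one hk1.ne']
      congr 1
      ring
    have h4 : (k : ℝ) ^ (-α) / k ≤ 2 / α * ((k : ℝ) ^ (-α) * (α / (k + 1))) := by
      have h5 : 0 < (k : ℝ) ^ (-α) := by positivity
      rw [show 2 / α * ((k : ℝ) ^ (-α) * (α / (k + 1))) = (k : ℝ) ^ (-α) * (2 / (k + 1)) by
        field_simp, div_eq_mul_one_div]
      refine mul_le_mul_of_nonneg_left ?_ h5.le
      rw [div_le_div_iff₀ hk1 hk2]
      linarith
    have h6 : 2 / α * ((k : ℝ) ^ (-α) * (α / (k + 1)))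
        ≤ 2 / α * ((k : ℝ) ^ (-α) - ((k : ℝ) + 1) ^ (-α)) := by
      refine mul_le_mul_of_nonneg_left ?_ (by positivity)
      linarith
    rw [h3]
    push_cast
    linarith

/-- With `α = min θ 1`, Bernoulli gives `(j/(j+1))^(1-α) ≤ (j+α)/(j+1) ≤ (j+θ)/(j+1)`, and the last
ratio is that of consecutive coefficients. Monotonicity replaces the asymptotics `n^(θ-1)/Γ(θ)` of
the coefficients. -/
lemma risingCoeff_mul_rpow_mono {θ : ℝ} (hθ : 0 < θ) :
    Monotone fun j : ℕ ↦ risingCoeff θ j * (j : ℝ) ^ (1 - min θ 1) := by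
  refine monotone_nat_of_le_succ fun j ↦ ?_
  have hα0 : 0 < min θ 1 := lt_min hθ one_pos
  have hα1 : min θ 1 ≤ 1 := min_le_right _ _
  have hj : (0 : ℝ) < j + 1 := by positivity
  have h := rpow_sub_one_le (a := 1 - min θ 1) (by linarith) (by linarith)
    (show (1 : ℝ) ≤ j + 1 by simp)
  rw [add_sub_cancel_right] at h
  rw [risingCoeff_succ, mul_assoc]
  refine mul_le_mul_of_nonneg_left (h.trans ?_) (risingCoeff_pos hθ j).le
  push_cast
  rw [mul_comm]
  refine mul_le_mul_of_nonneg_right ?_ (by positivity)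
  rw [one_sub_div hj.ne']
  gcongr
  linarith [min_le_left θ 1]

/-- The bound, up to constants, for the error probabilities of the Feller coupling. -/
noncomputable def couplingWeight (θ : ℝ) (n m : ℕ) : ℝ :=
  (n : ℝ) ^ (-min θ 1) * (((n - m : ℕ) : ℝ) + 1) ^ (min θ 1 - 1)

lemma couplingWeight_nonneg (θ : ℝ) (n m : ℕ) : 0 ≤ couplingWeight θ n m := by
  unfold couplingWeight
  positivity

lemma lastCycleProb_le {θ : ℝ} (hθ : 0 < θ) {k m : ℕ} (hm : 1 ≤ m) (hmk : m ≤ k) :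
    lastCycleProb θ k m ≤ (2 * θ + 1) * couplingWeight θ k m := by
  have hα0 : 0 < min θ 1 := lt_min hθ one_pos
  have hα1 : min θ 1 ≤ 1 := min_le_right _ _
  have hk : (0 : ℝ) < k := by exact_mod_cast lt_of_lt_of_le hm hmk
  have hd := risingCoeff_pos hθ k
  -- The `2` comes from `j + 1 ≤ 2 j` for `j = k - m ≥ 1`. At `j = 0` the monotone quantity may
  -- vanish, so the comparison is with index `1`, where the coefficient is `θ`; this costs `1 / θ`.
  have key : risingCoeff θ (k - m) * (((k - m : ℕ) : ℝ) + 1) ^ (1 - min θ 1)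
      ≤ (2 + 1 / θ) * (risingCoeff θ k * (k : ℝ) ^ (1 - min θ 1)) := by
    have hX : 0 ≤ risingCoeff θ k * (k : ℝ) ^ (1 - min θ 1) := by positivity
    rcases Nat.eq_zero_or_pos (k - m) with h | h
    · rw [h, risingCoeff_zero]
      have h1 := risingCoeff_mul_rpow_mono hθ (hm.trans hmk)
      have h2 : risingCoeff θ 1 = θ := by simp [risingCoeff]
      simp only [h2, Nat.cast_one, Real.one_rpow, mul_one] at h1
      have h3 : 1 ≤ 1 / θ * (risingCoeff θ k * (k : ℝ) ^ (1 - min θ 1)) := by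
        rw [one_div, inv_mul_eq_div, le_div_iff₀ hθ, one_mul]
        exact h1
      simp only [Nat.cast_zero, zero_add, Real.one_rpow, mul_one]
      nlinarith
    · have h1 := risingCoeff_mul_rpow_mono hθ (Nat.sub_le k m)
      simp only at h1
      have hj : (1 : ℝ) ≤ (k - m : ℕ) := by exact_mod_cast h
      have h2 : (((k - m : ℕ) : ℝ) + 1) ^ (1 - min θ 1)
          ≤ 2 * ((k - m : ℕ) : ℝ) ^ (1 - min θ 1) := by
        calc (((k - m : ℕ) : ℝ) + 1) ^ (1 - min θ 1)
            ≤ (2 * ((k - m : ℕ) : ℝ)) ^ (1 - min θ 1) :=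
              Real.rpow_le_rpow (by positivity) (by linarith) (by linarith)
          _ = 2 ^ (1 - min θ 1) * ((k - m : ℕ) : ℝ) ^ (1 - min θ 1) :=
              Real.mul_rpow (by norm_num) (by positivity)
          _ ≤ 2 * ((k - m : ℕ) : ℝ) ^ (1 - min θ 1) := by
              refine mul_le_mul_of_nonneg_right ?_ (by positivity)
              calc (2 : ℝ) ^ (1 - min θ 1) ≤ 2 ^ (1 : ℝ) :=
                    Real.rpow_le_rpow_of_exponent_le (by norm_num) (by linarith)
                _ = 2 := Real.rpow_one 2
      have h3 := mul_le_mul_of_nonneg_left h2 (risingCoeff_pos hθ (k - m)).le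
      have h4 : 0 ≤ 1 / θ * (risingCoeff θ k * (k : ℝ) ^ (1 - min θ 1)) := by positivity
      linarith
  have hj0 : (0 : ℝ) < ((k - m : ℕ) : ℝ) + 1 := by positivity
  have e1 : (((k - m : ℕ) : ℝ) + 1) ^ (min θ 1 - 1)
      = ((((k - m : ℕ) : ℝ) + 1) ^ (1 - min θ 1))⁻¹ := by
    rw [← Real.rpow_neg hj0.le, neg_sub]
  have e2 : (k : ℝ) ^ (-min θ 1) = (k : ℝ) ^ (1 - min θ 1) / k := by
    rw [← Real.rpow_sub_one hk.ne']
    congr 1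
    ring
  rw [lastCycleProb, couplingWeight, e1, e2, ← div_eq_mul_inv, ← mul_div_assoc, ← mul_div_assoc,
    le_div_iff₀ (by positivity)]
  have e3 : θ / k * risingCoeff θ (k - m) / risingCoeff θ k
      * (((k - m : ℕ) : ℝ) + 1) ^ (1 - min θ 1)
      = θ / (k * risingCoeff θ k)
        * (risingCoeff θ (k - m) * (((k - m : ℕ) : ℝ) + 1) ^ (1 - min θ 1)) := by
    field_simp
  rw [e3]
  refine (mul_le_mul_of_nonneg_left key (by positivity)).trans (le_of_eq ?_)
  field_simp

lemma lastCycleProb_le_of_le {θ : ℝ} (hθ : 0 < θ) {n k m : ℕ} (hm : 1 ≤ m) (hmn : m ≤ n)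
    (hnk : n ≤ k) :
    lastCycleProb θ k m
      ≤ (2 * θ + 1) * ((k : ℝ) ^ (-min θ 1) * (((n - m : ℕ) : ℝ) + 1) ^ (min θ 1 - 1)) := by
  refine (lastCycleProb_le hθ hm (hmn.trans hnk)).trans ?_
  refine mul_le_mul_of_nonneg_left (mul_le_mul_of_nonneg_left ?_ (by positivity)) (by positivity)
  refine Real.rpow_le_rpow_of_nonpos (by positivity) ?_ (by linarith [min_le_right θ 1])
  have : n - m ≤ k - m := Nat.sub_le_sub_right hnk m
  have : ((n - m : ℕ) : ℝ) ≤ (k - m : ℕ) := by exact_mod_cast this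
  linarith

/-- The left side is the error of `norm_sub_le_of_renewal` for one cycle length. Each endpoint
contributes at most `w(n,m)` and the sum over `k` at most `θ (2/α) w(n,m)`, up to the common factor
`2θ + 1`, whatever `N` is. -/
lemma renewal_error_single_le {θ : ℝ} (hθ : 0 < θ) {n N m : ℕ} (hm : 1 ≤ m) (hmn : m ≤ n)
    (hnN : n ≤ N) :
    lastCycleProb θ n m + lastCycleProb θ N m
        + ∑ k ∈ Finset.Ico n N, θ / (θ + k) * lastCycleProb θ k m
      ≤ (2 * θ + 1) * (2 + θ * (2 / min θ 1)) * couplingWeight θ n m := by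
  have hα0 : 0 < min θ 1 := lt_min hθ one_pos
  have hα1 : min θ 1 ≤ 1 := min_le_right _ _
  have hn : (0 : ℝ) < n := by exact_mod_cast lt_of_lt_of_le hm hmn
  set c : ℝ := (((n - m : ℕ) : ℝ) + 1) ^ (min θ 1 - 1) with hc
  have hc0 : 0 ≤ c := by positivity
  have h1 := lastCycleProb_le_of_le hθ hm hmn le_rfl
  have h2 : lastCycleProb θ N m ≤ (2 * θ + 1) * ((n : ℝ) ^ (-min θ 1) * c) := by
    refine (lastCycleProb_le_of_le hθ hm hmn hnN).trans ?_
    refine mul_le_mul_of_nonneg_left (mul_le_mul_of_nonneg_right ?_ hc0) (by positivity)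
    exact Real.rpow_le_rpow_of_nonpos hn (by exact_mod_cast hnN) (by linarith)
  have h3 : ∑ k ∈ Finset.Ico n N, θ / (θ + k) * lastCycleProb θ k m
      ≤ ∑ k ∈ Finset.Ico n N, (2 * θ + 1) * θ * c * (k : ℝ) ^ (-1 - min θ 1) := by
    refine Finset.sum_le_sum fun k hk ↦ ?_
    have hk1 := (Finset.mem_Ico.1 hk).1
    have hk0 : (0 : ℝ) < k := lt_of_lt_of_le hn (by exact_mod_cast hk1)
    calc θ / (θ + k) * lastCycleProb θ k m
        ≤ θ / k * ((2 * θ + 1) * ((k : ℝ) ^ (-min θ 1) * c)) := by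
          refine mul_le_mul ?_ (lastCycleProb_le_of_le hθ hm hmn hk1)
            (lastCycleProb_nonneg hθ k m) (by positivity)
          gcongr
          linarith
      _ = (2 * θ + 1) * θ * c * ((k : ℝ) ^ (-min θ 1) / k) := by ring
      _ = (2 * θ + 1) * θ * c * (k : ℝ) ^ (-1 - min θ 1) := by
          rw [← Real.rpow_sub_one hk0.ne']
          congr 2
          ring
  rw [← Finset.mul_sum] at h3
  have h4 := mul_le_mul_of_nonneg_left
    (sum_rpow_neg_one_sub_le hα0 hα1 (hm.trans hmn) hnN)
    (show 0 ≤ (2 * θ + 1) * θ * c by positivity)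
  rw [couplingWeight, ← hc]
  calc _ ≤ (2 * θ + 1) * ((n : ℝ) ^ (-min θ 1) * c) + (2 * θ + 1) * ((n : ℝ) ^ (-min θ 1) * c)
        + (2 * θ + 1) * θ * c * (2 / min θ 1 * (n : ℝ) ^ (-min θ 1)) :=
          add_le_add (add_le_add h1 h2) (h3.trans h4)
    _ = _ := by ring

lemma renewal_error_le {θ : ℝ} (hθ : 0 < θ) {n N : ℕ} (hnN : n ≤ N)
    {a : ℕ → ℝ} (ha : ∀ m, 0 ≤ a m) :
    (∑ m ∈ Finset.Icc 1 n, lastCycleProb θ n m * a m)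
        + (∑ m ∈ Finset.Icc 1 n, lastCycleProb θ N m * a m)
        + ∑ k ∈ Finset.Ico n N, θ / (θ + k) * ∑ m ∈ Finset.Icc 1 n, lastCycleProb θ k m * a m
      ≤ (2 * θ + 1) * (2 + θ * (2 / min θ 1))
        * ∑ m ∈ Finset.Icc 1 n, couplingWeight θ n m * a m := by
  simp_rw [Finset.mul_sum]
  rw [Finset.sum_comm, ← Finset.sum_add_distrib, ← Finset.sum_add_distrib]
  refine Finset.sum_le_sum fun m hm ↦ ?_
  obtain ⟨h1, h2⟩ := Finset.mem_Icc.1 hm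
  simp_rw [← mul_assoc]
  rw [← Finset.sum_mul, ← add_mul, ← add_mul]
  exact mul_le_mul_of_nonneg_right (renewal_error_single_le hθ h1 h2 hnN) (ha m)

/-- Hölder's inequality for the coupling weights. -/
lemma exists_sum_couplingWeight_le {θ p : ℝ} (hp1 : 1 < p) (hp : 1 / p < min θ 1) :
    ∃ K : ℝ, 0 ≤ K ∧ ∀ (n : ℕ) (a : ℕ → ℝ), 1 ≤ n → (∀ m, 0 ≤ a m) →
      ∑ m ∈ Finset.Icc 1 n, couplingWeight θ n m * a m
        ≤ K * (∑ m ∈ Finset.Icc 1 n, 1 / (m : ℝ) * a m ^ p) ^ (1 / p) := by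
  set α := min θ 1 with hα
  have hα1 : α ≤ 1 := min_le_right _ _
  have hp0 : 0 < p := by linarith
  obtain ⟨q, hpq⟩ : ∃ q, p.HolderConjugate q := ⟨_, Real.HolderConjugate.conjExponent hp1⟩
  have hq0 : 0 < q := hpq.symm.pos
  have hqp : q / p = q - 1 := by
    have := hpq.inv_add_inv_eq_one
    field_simp at this ⊢
    linarith
  have hs0 : 0 ≤ (1 - α) * q := mul_nonneg (by linarith) hq0.le
  -- Equivalent to `1 / p < α`: the `q`-th power of the singularity of the weight at `m = n` then
  -- has a sum of order `n ^ (1 - (1 - α) q)`.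
  have hs1 : (1 - α) * q < 1 := by
    have : q * (1 / p) < q * α := mul_lt_mul_of_pos_left hp hq0
    have h2 : q * (1 / p) = q - 1 := by rw [← hqp]; ring
    linarith
  refine ⟨(1 / (1 - (1 - α) * q)) ^ (1 / q), by
    have : 0 < 1 - (1 - α) * q := by linarith
    positivity, fun n a hn ha ↦ ?_⟩
  have hn0 : (0 : ℝ) < n := by exact_mod_cast hn
  have hm0 : ∀ m ∈ Finset.Icc 1 n, (0 : ℝ) < m := fun m hm ↦ by
    exact_mod_cast (Finset.mem_Icc.1 hm).1
  have h1 := Real.inner_le_Lp_mul_Lq_of_nonneg (Finset.Icc 1 n) hpq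
    (f := fun m : ℕ ↦ a m * (m : ℝ) ^ (-(1 / p))) (g := fun m ↦ (m : ℝ) ^ (1 / p) * couplingWeight θ n m)
    (fun m _ ↦ mul_nonneg (ha m) (by positivity))
    (fun m _ ↦ mul_nonneg (by positivity) (couplingWeight_nonneg θ n m))
  have e1 : ∑ m ∈ Finset.Icc 1 n, a m * (m : ℝ) ^ (-(1 / p)) * ((m : ℝ) ^ (1 / p) * couplingWeight θ n m)
      = ∑ m ∈ Finset.Icc 1 n, couplingWeight θ n m * a m := by
    refine Finset.sum_congr rfl fun m hm ↦ ?_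
    have : (m : ℝ) ^ (-(1 / p)) * (m : ℝ) ^ (1 / p) = 1 := by
      rw [← Real.rpow_add (hm0 m hm), neg_add_cancel, Real.rpow_zero]
    calc _ = ((m : ℝ) ^ (-(1 / p)) * (m : ℝ) ^ (1 / p)) * (couplingWeight θ n m * a m) := by ring
      _ = _ := by rw [this, one_mul]
  have e2 : ∑ m ∈ Finset.Icc 1 n, (a m * (m : ℝ) ^ (-(1 / p))) ^ p
      = ∑ m ∈ Finset.Icc 1 n, 1 / (m : ℝ) * a m ^ p := by
    refine Finset.sum_congr rfl fun m hm ↦ ?_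
    have hm := hm0 m hm
    rw [Real.mul_rpow (ha m) (by positivity), ← Real.rpow_mul hm.le,
      show -(1 / p) * p = -1 by field_simp, Real.rpow_neg_one, one_div, mul_comm]
  have e3 : ∑ m ∈ Finset.Icc 1 n, ((m : ℝ) ^ (1 / p) * couplingWeight θ n m) ^ q
      ≤ 1 / (1 - (1 - α) * q) := by
    calc ∑ m ∈ Finset.Icc 1 n, ((m : ℝ) ^ (1 / p) * couplingWeight θ n m) ^ q
        ≤ ∑ m ∈ Finset.Icc 1 n, (n : ℝ) ^ (q / p - α * q)
            * (((n - m : ℕ) : ℝ) + 1) ^ (-((1 - α) * q)) := by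
          refine Finset.sum_le_sum fun m hm ↦ ?_
          have hm' := hm0 m hm
          have hmn : (m : ℝ) ≤ n := by exact_mod_cast (Finset.mem_Icc.1 hm).2
          have hj : (0 : ℝ) < ((n - m : ℕ) : ℝ) + 1 := by positivity
          rw [couplingWeight, ← hα]
          calc ((m : ℝ) ^ (1 / p) * ((n : ℝ) ^ (-α) * (((n - m : ℕ) : ℝ) + 1) ^ (α - 1))) ^ q
              ≤ ((n : ℝ) ^ (1 / p) * ((n : ℝ) ^ (-α) * (((n - m : ℕ) : ℝ) + 1) ^ (α - 1))) ^ q := by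
                gcongr
            _ = (n : ℝ) ^ (q / p - α * q) * (((n - m : ℕ) : ℝ) + 1) ^ (-((1 - α) * q)) := by
                rw [← mul_assoc, ← Real.rpow_add hn0, Real.mul_rpow (by positivity) (by positivity),
                  ← Real.rpow_mul hn0.le, ← Real.rpow_mul hj.le]
                congr 2 <;> ring
      _ = (n : ℝ) ^ (q / p - α * q) * ∑ j ∈ Finset.range n, ((j : ℝ) + 1) ^ (-((1 - α) * q)) := by
          rw [← Finset.mul_sum,
            sum_Icc_sub n fun j ↦ ((j : ℝ) + 1) ^ (-((1 - α) * q))]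
      _ ≤ (n : ℝ) ^ (q / p - α * q) * ((n : ℝ) ^ (1 - (1 - α) * q) / (1 - (1 - α) * q)) :=
          mul_le_mul_of_nonneg_left (sum_rpow_neg_le hs0 hs1 n) (by positivity)
      -- The powers of `n` cancel exactly, so the Hölder constant is uniform in `n`.
      _ = 1 / (1 - (1 - α) * q) := by
          rw [← mul_div_assoc, ← Real.rpow_add hn0, hqp,
            show q - 1 - α * q + (1 - (1 - α) * q) = 0 by ring, Real.rpow_zero]
  rw [e1, e2, mul_comm] at h1
  refine h1.trans (mul_le_mul_of_nonneg_right ?_ (Real.rpow_nonneg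
    (Finset.sum_nonneg fun m _ ↦ mul_nonneg (by positivity) (Real.rpow_nonneg (ha m) _)) _))
  refine Real.rpow_le_rpow (Finset.sum_nonneg fun m _ ↦ ?_) e3 (by positivity)
  have := couplingWeight_nonneg θ n m
  positivity

end EwensCLT

namespace EwensCLT

/-! ### Comparison of the Ewens distribution with independent Poisson variables -/

/-- The expected number of cycles of length `m` under the Ewens distribution. -/
noncomputable def ewensMean (θ : ℝ) (n m : ℕ) : ℝ :=
  θ / m * (risingCoeff θ (n - m) / risingCoeff θ n)

lemma tendsto_risingCoeff_ratio {θ : ℝ} (hθ : 0 < θ) (m : ℕ) :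
    Tendsto (fun n ↦ risingCoeff θ (n - m) / risingCoeff θ n) atTop (𝓝 1) := by
  rw [← tendsto_add_atTop_iff_nat m]
  simp_rw [Nat.add_sub_cancel]
  induction m with
  | zero => simp [div_self (risingCoeff_pos hθ _).ne']
  | succ m ih =>
    have h : Tendsto (fun n : ℕ ↦ ((n : ℝ) + (m + 1)) / (n + (θ + m))) atTop (𝓝 1) := by
      have := tendsto_add_mul_div_add_mul_atTop_nhds (m + 1 : ℝ) (θ + m) 1 one_ne_zero
      simp only [one_mul, div_one] at this
      exact this.congr fun n ↦ by rw [add_comm (n : ℝ), add_comm (n : ℝ)]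
    have h2 := ih.mul h
    rw [mul_one] at h2
    refine h2.congr fun n ↦ ?_
    have h3 := risingCoeff_pos hθ (n + m)
    have h4 : (0 : ℝ) < n + (θ + m) := by positivity
    have h5 : (0 : ℝ) < n + m + 1 := by positivity
    have h6 : (0 : ℝ) < θ + (n + m) := by positivity
    rw [← add_assoc n m 1, risingCoeff_succ]
    push_cast
    rw [div_mul_div_comm, ← mul_div_assoc, div_div_eq_mul_div]
    congr 1
    · ring
    · ring

/-- The constant in the comparison with independent Poisson variables. -/
noncomputable def couplingConst (θ : ℝ) : ℝ := (2 * θ + 1) * (2 + θ * (2 / min θ 1))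

lemma couplingConst_nonneg {θ : ℝ} (hθ : 0 < θ) : 0 ≤ couplingConst θ := by
  have : 0 < min θ 1 := lt_min hθ one_pos
  unfold couplingConst
  positivity

lemma abs_ewensMean_sub_le {θ : ℝ} (hθ : 0 < θ) {n m : ℕ} (hm : 1 ≤ m) (hmn : m ≤ n) :
    |ewensMean θ n m - θ / m| ≤ couplingConst θ * couplingWeight θ n m := by
  have hm0 : (0 : ℝ) < m := by exact_mod_cast hm
  have hlim : Tendsto (fun N ↦ |ewensMean θ n m - ewensMean θ N m|) atTop
      (𝓝 |ewensMean θ n m - θ / m|) := by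
    have := (tendsto_risingCoeff_ratio hθ m).const_mul (θ / m)
    rw [mul_one] at this
    exact (tendsto_const_nhds.sub this).abs
  refine le_of_tendsto hlim ?_
  filter_upwards [eventually_ge_atTop n] with N hN
  rw [abs_sub_comm, ← Real.norm_eq_abs]
  -- Here `M` is the mean number of completed cycles of length `m`: all of them, less the last cycle
  -- if it has that length.
  refine (norm_sub_le_of_renewal (G := fun k ↦ ewensMean θ k m)
    (M := fun k ↦ ewensMean θ k m - lastCycleProb θ k m) (δ := fun k ↦ lastCycleProb θ k m)
    hθ hN ?_ ?_).trans (renewal_error_single_le hθ hm hmn hN)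
  · intro k _
    simp [abs_of_nonneg (lastCycleProb_nonneg hθ k m)]
  · intro k hk
    have hkm : m ≤ k := hmn.trans hk
    rw [sub_sub_cancel, ← Real.norm_of_nonneg (show 0 ≤ θ / (θ + k) by positivity), ← norm_mul]
    refine le_of_eq (congrArg _ ?_)
    obtain ⟨j, rfl⟩ := Nat.exists_eq_add_of_le hkm
    have h1 := risingCoeff_pos hθ j
    have h2 := risingCoeff_pos hθ (m + j)
    have h3 : (0 : ℝ) < θ + j := by positivity
    have h4 : (0 : ℝ) < θ + (m + j) := by positivity
    have h5 : (0 : ℝ) < m + j := by positivity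
    have h6 : (0 : ℝ) < j + 1 := by positivity
    have h7 : (0 : ℝ) < m + j + 1 := by positivity
    simp only [ewensMean, lastCycleProb]
    rw [show m + j + 1 - m = j + 1 by omega, show m + j - m = j by omega, risingCoeff_succ,
      risingCoeff_succ]
    push_cast
    field_simp
    ring

/-- Cycles longer than `n` carry weight one, so at every size `k ≥ n` the error involves only
lengths up to `n`. The bound is therefore free of `N`, which permits the passage `N → ∞`. -/
lemma norm_ewensGen_sub_le {θ : ℝ} (hθ : 0 < θ) {ψ : ℕ → ℂ} (hψ : ∀ m, ‖ψ m‖ ≤ 1) {n N : ℕ}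
    (hn : 1 ≤ n) (hnN : n ≤ N) (hψn : ∀ m, n < m → ψ m = 1) :
    ‖ewensGen θ ψ N - ewensGen θ ψ n‖
      ≤ couplingConst θ * ∑ m ∈ Finset.Icc 1 n, couplingWeight θ n m * ‖ψ m - 1‖ := by
  refine (norm_sub_le_of_renewal (M := ewensGenCompleted θ ψ)
    (δ := fun k ↦ ∑ m ∈ Finset.Icc 1 n, lastCycleProb θ k m * ‖ψ m - 1‖) hθ hnN ?_ ?_).trans
    (renewal_error_le hθ hnN fun m ↦ norm_nonneg _)
  · intro k hk
    refine (norm_ewensGen_sub_completed_le hθ hψ (hn.trans hk)).trans (le_of_eq ?_)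
    refine (Finset.sum_subset (Finset.Icc_subset_Icc_right hk) fun m hm hm' ↦ ?_).symm
    rw [hψn m (by simp only [Finset.mem_Icc] at hm hm'; omega), sub_self, norm_zero, mul_zero]
  · intro k hk
    rw [ewensGenCompleted_succ hθ ψ (hn.trans hk), norm_mul, Complex.norm_real,
      Real.norm_of_nonneg (show 0 ≤ θ / (θ + k) by positivity)]

lemma norm_one_add_mul_sub_one_le {u : ℝ} (hu0 : 0 ≤ u) (hu1 : u ≤ 1) {z : ℂ} (hz : ‖z‖ ≤ 1) :
    ‖1 + (u : ℂ) * (z - 1)‖ ≤ 1 := by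
  have h : 1 + (u : ℂ) * (z - 1) = ((1 - u : ℝ) : ℂ) + (u : ℂ) * z := by push_cast; ring
  rw [h]
  refine (norm_add_le _ _).trans ?_
  rw [norm_mul, Complex.norm_real, Complex.norm_real, Real.norm_of_nonneg hu0,
    Real.norm_of_nonneg (sub_nonneg.2 hu1)]
  nlinarith

lemma hasDerivAt_ewensGen {θ : ℝ} (hθ : 0 < θ) {ψ : ℕ → ℂ} {n N : ℕ} (hnN : n ≤ N)
    (hψn : ∀ m, n < m → ψ m = 1) (u : ℝ) :
    HasDerivAt (fun v : ℝ ↦ ewensGen θ (fun m ↦ 1 + (v : ℂ) * (ψ m - 1)) N)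
      (∑ m ∈ Finset.Icc 1 n, (θ / m * (ψ m - 1))
        * ((risingCoeff θ (N - m) / risingCoeff θ N : ℝ)
          * ewensGen θ (fun m ↦ 1 + (u : ℂ) * (ψ m - 1)) (N - m))) u := by
  have h1 : ∀ m, HasDerivAt (fun v : ℝ ↦ (θ : ℂ) * (1 + (v : ℂ) * (ψ m - 1)))
      (θ * (ψ m - 1)) u := fun m ↦ by
    have := (((Complex.ofRealCLM.hasDerivAt (x := u)).mul_const (ψ m - 1)).const_add 1).const_mul
      (θ : ℂ)
    simpa using this
  refine ((hasDerivAt_cyclePoly N h1).div_const (risingCoeff θ N : ℂ)).congr_deriv ?_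
  rw [Finset.sum_div]
  refine Eq.symm ((Finset.sum_congr rfl fun m _ ↦ ?_).trans
    (Finset.sum_subset (Finset.Icc_subset_Icc_right hnN) fun m hm hm' ↦ ?_))
  · have h2 : (risingCoeff θ (N - m) : ℂ) ≠ 0 :=
      Complex.ofReal_ne_zero.2 (risingCoeff_pos hθ _).ne'
    rw [ewensGen]
    push_cast
    field_simp
  · rw [hψn m (by simp only [Finset.mem_Icc] at hm hm'; omega)]
    simp

lemma ewensGen_one {θ : ℝ} (hθ : 0 < θ) (n : ℕ) : ewensGen θ (fun _ ↦ 1) n = 1 := by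
  simp_rw [ewensGen, mul_one]
  rw [cyclePoly_const, div_self (Complex.ofReal_ne_zero.2 (risingCoeff_pos hθ _).ne')]

lemma sum_couplingWeight_le {θ : ℝ} {n k : ℕ} (hnk : n ≤ k) (a : ℕ → ℝ) (ha : ∀ m, 0 ≤ a m)
    (ha' : ∀ m, n < m → a m = 0) :
    ∑ m ∈ Finset.Icc 1 k, couplingWeight θ k m * a m
      ≤ (k : ℝ) ^ (-min θ 1) * ∑ m ∈ Finset.Icc 1 n, a m := by
  rw [← Finset.sum_subset (Finset.Icc_subset_Icc_right hnk) fun m hm hm' ↦ by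
    rw [ha' m (by simp only [Finset.mem_Icc] at hm hm'; omega), mul_zero], Finset.mul_sum]
  refine Finset.sum_le_sum fun m _ ↦ mul_le_mul_of_nonneg_right ?_ (ha m)
  refine mul_le_of_le_one_right (by positivity) (Real.rpow_le_one_of_one_le_of_nonpos ?_ ?_)
  · simp
  · linarith [min_le_right θ 1]

/-- Interpolate by `ψ^u = 1 + u (ψ - 1)`. The `u`-derivative of `G_N` is `∑ (θ/m)(ψ_m - 1) r(N,m)
G_{N-m}`, where `r(N,m) → 1` and `G_{N-m} - G_N → 0` by the renewal estimate. So `G_N` nearly solves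
`G' = L G` with `G = 1` at `u = 0`. -/
lemma tendsto_ewensGen {θ : ℝ} (hθ : 0 < θ) {ψ : ℕ → ℂ} (hψ : ∀ m, ‖ψ m‖ ≤ 1) {n : ℕ}
    (hn : 1 ≤ n) (hψn : ∀ m, n < m → ψ m = 1) :
    Tendsto (ewensGen θ ψ) atTop
      (𝓝 (Complex.exp (∑ m ∈ Finset.Icc 1 n, θ / m * (ψ m - 1)))) := by
  set L : ℂ := ∑ m ∈ Finset.Icc 1 n, θ / m * (ψ m - 1) with hL
  have hα0 : 0 < min θ 1 := lt_min hθ one_pos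
  set B : ℝ := ∑ m ∈ Finset.Icc 1 n, ‖ψ m - 1‖
  set r : ℕ → ℕ → ℝ := fun N m ↦ risingCoeff θ (N - m) / risingCoeff θ N
  set ε : ℕ → ℝ := fun N ↦ Real.exp ‖L‖ * ∑ m ∈ Finset.Icc 1 n, ‖θ / m * (ψ m - 1)‖
    * (|r N m - 1| + couplingConst θ * (((N - n : ℕ) : ℝ) ^ (-min θ 1) * B)) with hε
  have hε0 : Tendsto ε atTop (𝓝 0) := by
    have h1 : ∀ m ∈ Finset.Icc 1 n, Tendsto (fun N ↦ ‖θ / m * (ψ m - 1)‖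
        * (|r N m - 1| + couplingConst θ * (((N - n : ℕ) : ℝ) ^ (-min θ 1) * B))) atTop
        (𝓝 (‖θ / m * (ψ m - 1)‖ * (|1 - 1| + couplingConst θ * (0 * B)))) := fun m _ ↦ by
      refine Tendsto.const_mul _ (Tendsto.add ((tendsto_risingCoeff_ratio hθ m).sub_const 1).abs
        (Tendsto.const_mul _ (Tendsto.mul_const _ ?_)))
      exact (tendsto_rpow_neg_atTop hα0).comp
        (tendsto_natCast_atTop_atTop.comp (tendsto_sub_atTop_nat n))
    have h2 := (tendsto_finsetSum _ h1).const_mul (Real.exp ‖L‖)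
    have h3 : Real.exp ‖L‖ * ∑ m ∈ Finset.Icc 1 n,
        ‖θ / m * (ψ m - 1)‖ * (|(1 : ℝ) - 1| + couplingConst θ * (0 * B)) = 0 := by simp
    rwa [h3] at h2
  have key : ∀ᶠ N in atTop, ‖Complex.exp (-L) * ewensGen θ ψ N - 1‖ ≤ ε N := by
    -- This gives `N - m ≥ n` for all `m ≤ n`, so the renewal estimate can start at size `N - m`.
    filter_upwards [eventually_ge_atTop (2 * n)] with N hN
    set F : ℕ → ℝ → ℂ := fun k u ↦ ewensGen θ (fun m ↦ 1 + (u : ℂ) * (ψ m - 1)) k with hF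
    have hH : ∀ u : ℝ, HasDerivAt (fun v : ℝ ↦ Complex.exp (-(v * L)) * F N v)
        (Complex.exp (-(u * L)) * ∑ m ∈ Finset.Icc 1 n, (θ / m * (ψ m - 1))
          * ((r N m : ℂ) * F (N - m) u - F N u)) u := fun u ↦ by
      have h1 : HasDerivAt (fun v : ℝ ↦ Complex.exp (-(v * L)))
          (Complex.exp (-(u * L)) * -(1 * L)) u :=
        (((Complex.ofRealCLM.hasDerivAt (x := u)).mul_const L).neg).cexp
      refine (h1.mul (hasDerivAt_ewensGen hθ (by omega) hψn u)).congr_deriv ?_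
      have h2 : ∑ m ∈ Finset.Icc 1 n, (θ / m * (ψ m - 1)) * ((r N m : ℂ) * F (N - m) u - F N u)
          = (∑ m ∈ Finset.Icc 1 n, (θ / m * (ψ m - 1)) * ((r N m : ℂ) * F (N - m) u))
            - L * F N u := by
        rw [hL, Finset.sum_mul, ← Finset.sum_sub_distrib]
        exact Finset.sum_congr rfl fun m _ ↦ mul_sub _ _ _
      rw [h2]
      simp only [hF, r]
      ring
    have hb : ∀ u ∈ Set.Ico (0 : ℝ) 1, ‖Complex.exp (-(u * L)) * ∑ m ∈ Finset.Icc 1 n,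
        (θ / m * (ψ m - 1)) * ((r N m : ℂ) * F (N - m) u - F N u)‖ ≤ ε N := by
      intro u hu
      have hψu : ∀ m, ‖1 + (u : ℂ) * (ψ m - 1)‖ ≤ 1 := fun m ↦
        norm_one_add_mul_sub_one_le hu.1 hu.2.le (hψ m)
      rw [norm_mul, hε]
      refine mul_le_mul ?_ (norm_sum_le_of_le _ fun m hm ↦ ?_) (norm_nonneg _) (by positivity)
      · rw [Complex.norm_exp]
        refine Real.exp_le_exp.2 ((Complex.re_le_norm _).trans ?_)
        rw [norm_neg, norm_mul, Complex.norm_real, Real.norm_of_nonneg hu.1]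
        exact mul_le_of_le_one_left (norm_nonneg _) hu.2.le
      · obtain ⟨hm1, hm2⟩ := Finset.mem_Icc.1 hm
        rw [norm_mul]
        refine mul_le_mul_of_nonneg_left ?_ (norm_nonneg _)
        have h1 : (r N m : ℂ) * F (N - m) u - F N u
            = ((r N m - 1 : ℝ) : ℂ) * F (N - m) u - (F N u - F (N - m) u) := by
          push_cast
          ring
        rw [h1]
        refine (norm_sub_le _ _).trans (add_le_add ?_ ?_)
        · rw [norm_mul, Complex.norm_real, Real.norm_eq_abs]
          exact mul_le_of_le_one_right (abs_nonneg _) (norm_ewensGen_le_one hθ hψu _)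
        · refine (norm_ewensGen_sub_le hθ hψu (n := N - m) (by omega) (by omega) fun i hi ↦ by
            rw [hψn i (by omega)]; simp).trans
            (mul_le_mul_of_nonneg_left ?_ (couplingConst_nonneg hθ))
          refine (sum_couplingWeight_le (n := n) (by omega) _ (fun _ ↦ norm_nonneg _) fun i hi ↦ by
            rw [hψn i hi]; simp).trans ?_
          refine mul_le_mul ?_ (Finset.sum_le_sum fun i _ ↦ ?_)
            (Finset.sum_nonneg fun _ _ ↦ norm_nonneg _) (by positivity)
          · by_cases hNn : N - n = 0
            · omega
            · refine Real.rpow_le_rpow_of_nonpos ?_ ?_ (by linarith)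
              · exact_mod_cast Nat.pos_of_ne_zero hNn
              · exact_mod_cast Nat.sub_le_sub_left hm2 N
          · rw [add_sub_cancel_left, norm_mul, Complex.norm_real, Real.norm_of_nonneg hu.1]
            exact mul_le_of_le_one_left (norm_nonneg _) hu.2.le
    have h := norm_image_sub_le_of_norm_deriv_le_segment_01'
      (fun u _ ↦ (hH u).hasDerivWithinAt) hb
    simpa [hF, ewensGen_one hθ] using h
  have h1 : Tendsto (fun N ↦ Complex.exp (-L) * ewensGen θ ψ N) atTop (𝓝 1) := by
    rw [tendsto_iff_norm_sub_tendsto_zero]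
    exact squeeze_zero' (Eventually.of_forall fun _ ↦ norm_nonneg _) key hε0
  have h2 := h1.const_mul (Complex.exp L)
  simp_rw [← mul_assoc, ← Complex.exp_add, add_neg_cancel, Complex.exp_zero, one_mul, mul_one]
    at h2
  exact h2

/-- The generating function of the Ewens cycle counts is close to that of independent Poisson
variables with parameters `θ / m`. -/
lemma norm_ewensGen_sub_exp_le {θ : ℝ} (hθ : 0 < θ) {ψ : ℕ → ℂ} (hψ : ∀ m, ‖ψ m‖ ≤ 1) {n : ℕ}
    (hn : 1 ≤ n) :
    ‖ewensGen θ ψ n - Complex.exp (∑ m ∈ Finset.Icc 1 n, θ / m * (ψ m - 1))‖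
      ≤ couplingConst θ * ∑ m ∈ Finset.Icc 1 n, couplingWeight θ n m * ‖ψ m - 1‖ := by
  -- At size `n` only lengths up to `n` occur, so truncation changes nothing there and makes the
  -- limit `N → ∞` available.
  set χ : ℕ → ℂ := fun m ↦ if m ≤ n then ψ m else 1 with hχ
  have h1 : ∀ m ∈ Finset.Icc 1 n, χ m = ψ m := fun m hm ↦ if_pos (Finset.mem_Icc.1 hm).2
  have h2 : ∀ m, ‖χ m‖ ≤ 1 := fun m ↦ by
    simp only [hχ]
    split_ifs
    · exact hψ m
    · simp
  have h3 : ∀ m, n < m → χ m = 1 := fun m hm ↦ if_neg (by omega)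
  have h4 : ewensGen θ ψ n = ewensGen θ χ n := by
    rw [ewensGen, ewensGen, cyclePoly, cyclePoly]
    congr 1
    refine cycleAverage_congr fun p ↦ congrArg _ (Multiset.map_congr rfl fun i hi ↦ ?_)
    rw [h1 i (Finset.mem_Icc.2 ⟨p.parts_pos hi, p.le_of_mem_parts hi⟩)]
  have h5 : ∑ m ∈ Finset.Icc 1 n, (θ : ℂ) / m * (ψ m - 1)
      = ∑ m ∈ Finset.Icc 1 n, (θ : ℂ) / m * (χ m - 1) :=
    Finset.sum_congr rfl fun m hm ↦ by rw [h1 m hm]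
  have h6 : ∑ m ∈ Finset.Icc 1 n, couplingWeight θ n m * ‖ψ m - 1‖
      = ∑ m ∈ Finset.Icc 1 n, couplingWeight θ n m * ‖χ m - 1‖ :=
    Finset.sum_congr rfl fun m hm ↦ by rw [h1 m hm]
  rw [h4, h5, h6]
  refine le_of_tendsto (tendsto_const_nhds.sub (tendsto_ewensGen hθ h2 hn h3)).norm ?_
  filter_upwards [eventually_ge_atTop n] with N hN
  rw [norm_sub_rev]
  exact norm_ewensGen_sub_le hθ h2 hn hN h3

end EwensCLT

namespace EwensCLT

/-! ### Second order expansion of the characteristic function -/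

lemma norm_exp_mul_I_sub_le_of_abs_le_one {x : ℝ} (hx : |x| ≤ 1) :
    ‖Complex.exp (x * Complex.I) - 1 - x * Complex.I + x ^ 2 / 2‖ ≤ |x| ^ 3 := by
  have h := Complex.exp_bound (x := x * Complex.I) (by simpa using hx) (n := 3) (by norm_num)
  have h2 : ∑ m ∈ Finset.range 3, ((x : ℂ) * Complex.I) ^ m / (m.factorial : ℂ)
      = 1 + x * Complex.I - x ^ 2 / 2 := by
    simp only [Finset.sum_range_succ, Finset.sum_range_zero, Nat.factorial]
    push_cast
    rw [mul_pow (x : ℂ) Complex.I 2, Complex.I_sq]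
    ring
  rw [h2] at h
  have h3 : Complex.exp (x * Complex.I) - 1 - x * Complex.I + x ^ 2 / 2
      = Complex.exp (x * Complex.I) - (1 + x * Complex.I - x ^ 2 / 2) := by ring
  rw [h3]
  refine h.trans ?_
  rw [norm_mul, Complex.norm_I, mul_one, Complex.norm_real, Real.norm_eq_abs]
  refine mul_le_of_le_one_right (by positivity) ?_
  norm_num [Nat.factorial]

lemma norm_exp_mul_I_sub_le_sq (x : ℝ) :
    ‖Complex.exp (x * Complex.I) - 1 - x * Complex.I + x ^ 2 / 2‖ ≤ 4 * x ^ 2 := by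
  rcases le_total |x| 1 with hx | hx
  · refine (norm_exp_mul_I_sub_le_of_abs_le_one hx).trans ?_
    rw [← sq_abs x]
    nlinarith [abs_nonneg x, sq_nonneg |x|]
  · have h1 : ‖Complex.exp (x * Complex.I) - 1 - x * Complex.I + x ^ 2 / 2‖
        ≤ 1 + 1 + |x| + x ^ 2 / 2 := by
      refine (norm_add_le _ _).trans (add_le_add ((norm_sub_le _ _).trans (add_le_add
        ((norm_sub_le _ _).trans (add_le_add (Complex.norm_exp_ofReal_mul_I x).le ?_)) ?_)) ?_)
      · simp
      · simp
      · simp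
    refine h1.trans ?_
    rw [← sq_abs x]
    nlinarith

/-- Split at `|x| = ε`: the cubic bound serves below, while above it `x^2 ≤ ε^(2-p) |x|^p`. The
first term will be controlled by the variance, the second by the Lyapunov condition. -/
lemma norm_exp_mul_I_sub_le {ε p : ℝ} (hε0 : 0 < ε) (hε1 : ε ≤ 1) (hp : 2 ≤ p) (x : ℝ) :
    ‖Complex.exp (x * Complex.I) - 1 - x * Complex.I + x ^ 2 / 2‖
      ≤ ε * x ^ 2 + 4 * ε ^ (2 - p) * |x| ^ p := by
  rcases le_or_gt |x| ε with hx | hx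
  · have h1 := norm_exp_mul_I_sub_le_of_abs_le_one (hx.trans hε1)
    have h2 : |x| ^ 3 ≤ ε * x ^ 2 := by
      rw [← sq_abs x, pow_succ, mul_comm]
      exact mul_le_mul_of_nonneg_right hx (by positivity)
    have h3 : 0 ≤ 4 * ε ^ (2 - p) * |x| ^ p := by positivity
    linarith
  · have hx0 : 0 < |x| := hε0.trans hx
    have h1 := norm_exp_mul_I_sub_le_sq x
    have h2 : x ^ 2 ≤ ε ^ (2 - p) * |x| ^ p := by
      have h3 : x ^ 2 = |x| ^ (2 - p) * |x| ^ p := by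
        rw [← Real.rpow_add hx0, sub_add_cancel, Real.rpow_two, sq_abs]
      rw [h3]
      exact mul_le_mul_of_nonneg_right
        (Real.rpow_le_rpow_of_nonpos hε0 hx.le (by linarith)) (by positivity)
    have h3 : 0 ≤ ε * x ^ 2 := by positivity
    linarith

lemma integrable_abs_rpow {Ω : Type*} [MeasurableSpace Ω] {P : Measure Ω}
    {p : ℝ} (hp : 0 < p) {Y : Ω → ℝ} (hY : MemLp Y (ENNReal.ofReal p) P) :
    Integrable (fun ω ↦ |Y ω| ^ p) P := by
  have := hY.integrable_norm_rpow (by simpa using hp) ENNReal.ofReal_ne_top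
  simpa [ENNReal.toReal_ofReal hp.le] using this

section Moments

variable {Ω : Type*} [MeasurableSpace Ω] {P : Measure Ω} [IsProbabilityMeasure P] {Y : Ω → ℝ}

lemma norm_integral_exp_mul_I_le_one (Y : Ω → ℝ) :
    ‖∫ ω, Complex.exp (Y ω * Complex.I) ∂P‖ ≤ 1 := by
  have h := norm_integral_le_of_norm_le_const (μ := P) (C := 1)
    (Eventually.of_forall fun ω ↦ (Complex.norm_exp_ofReal_mul_I (Y ω)).le)
  simpa using h

lemma integrable_exp_mul_I (hY : AEStronglyMeasurable Y P) :
    Integrable (fun ω ↦ Complex.exp (Y ω * Complex.I)) P := by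
  refine Integrable.of_bound (C := 1) ?_
    (Eventually.of_forall fun ω ↦ (Complex.norm_exp_ofReal_mul_I (Y ω)).le)
  exact Complex.continuous_exp.comp_aestronglyMeasurable
    ((Complex.continuous_ofReal.comp_aestronglyMeasurable hY).mul_const _)

lemma norm_integral_exp_mul_I_sub_one_le (hY : Integrable Y P) {c : ℝ} (hc : 0 ≤ c) :
    ‖∫ ω, Complex.exp ((c * Y ω : ℝ) * Complex.I) ∂P - 1‖ ≤ c * ∫ ω, |Y ω| ∂P := by
  have h1 := integrable_exp_mul_I (hY.const_mul c).aestronglyMeasurable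
  have h2 : ∫ ω, Complex.exp ((c * Y ω : ℝ) * Complex.I) ∂P - 1
      = ∫ ω, (Complex.exp ((c * Y ω : ℝ) * Complex.I) - 1) ∂P := by
    rw [integral_sub h1 (integrable_const _)]
    simp
  rw [h2, ← integral_const_mul]
  refine norm_integral_le_of_norm_le (hY.abs.const_mul c) (Eventually.of_forall fun ω ↦ ?_)
  have h3 := Real.norm_exp_I_mul_ofReal_sub_one_le (x := c * Y ω)
  rw [mul_comm, Real.norm_eq_abs, abs_mul, abs_of_nonneg hc] at h3
  exact h3

lemma norm_integral_exp_mul_I_sub_le {p : ℝ} (hp : 2 ≤ p) (hY : MemLp Y (ENNReal.ofReal p) P)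
    {c ε : ℝ} (hc : 0 ≤ c) (hε0 : 0 < ε) (hε1 : ε ≤ 1) :
    ‖∫ ω, Complex.exp ((c * Y ω : ℝ) * Complex.I) ∂P - 1 - (c * ∫ ω, Y ω ∂P : ℝ) * Complex.I
        + (c ^ 2 * (∫ ω, Y ω ^ 2 ∂P) / 2 : ℝ)‖
      ≤ ε * (c ^ 2 * ∫ ω, Y ω ^ 2 ∂P) + 4 * ε ^ (2 - p) * (c ^ p * ∫ ω, |Y ω| ^ p ∂P) := by
  have hp0 : 0 < p := by linarith
  have hY1 : Integrable Y P := hY.integrable (by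
    rw [← ENNReal.ofReal_one]
    exact ENNReal.ofReal_le_ofReal (by linarith))
  have hY2 : Integrable (fun ω ↦ Y ω ^ 2) P := (hY.mono_exponent (by
    rw [show (2 : ENNReal) = ENNReal.ofReal 2 by simp]
    exact ENNReal.ofReal_le_ofReal hp)).integrable_sq
  have hYp := integrable_abs_rpow hp0 hY
  have h1 := integrable_exp_mul_I (hY1.const_mul c).aestronglyMeasurable
  have hYI : Integrable (fun ω ↦ ((c * Y ω : ℝ) : ℂ) * Complex.I) P :=
    (hY1.const_mul c).ofReal.mul_const _
  have hYS : Integrable (fun ω ↦ ((c * Y ω : ℝ) : ℂ) ^ 2 / 2) P := by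
    have : Integrable (fun ω ↦ ((c ^ 2 * Y ω ^ 2 / 2 : ℝ) : ℂ)) P :=
      ((hY2.const_mul (c ^ 2)).div_const 2).ofReal
    refine this.congr (Eventually.of_forall fun ω ↦ ?_)
    simp only
    push_cast
    ring
  have h2 : ∫ ω, Complex.exp ((c * Y ω : ℝ) * Complex.I) ∂P - 1
        - (c * ∫ ω, Y ω ∂P : ℝ) * Complex.I + (c ^ 2 * (∫ ω, Y ω ^ 2 ∂P) / 2 : ℝ)
      = ∫ ω, (Complex.exp ((c * Y ω : ℝ) * Complex.I) - 1 - ((c * Y ω : ℝ) : ℂ) * Complex.I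
        + ((c * Y ω : ℝ) : ℂ) ^ 2 / 2) ∂P := by
    have h4 : Integrable (fun ω ↦ Complex.exp ((c * Y ω : ℝ) * Complex.I) - 1) P :=
      h1.sub (integrable_const _)
    have h5 : Integrable (fun ω ↦ Complex.exp ((c * Y ω : ℝ) * Complex.I) - 1
        - ((c * Y ω : ℝ) : ℂ) * Complex.I) P := h4.sub hYI
    rw [integral_add h5 hYS, integral_sub h4 hYI, integral_sub h1 (integrable_const _),
      integral_mul_const, integral_complex_ofReal, integral_const_mul]
    have h3 : ∫ ω, ((c * Y ω : ℝ) : ℂ) ^ 2 / 2 ∂P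
        = ((c ^ 2 * (∫ ω, Y ω ^ 2 ∂P) / 2 : ℝ) : ℂ) := by
      rw [← integral_const_mul, ← integral_div, ← integral_complex_ofReal]
      refine integral_congr_ae (Eventually.of_forall fun ω ↦ ?_)
      simp only
      push_cast
      ring
    rw [h3]
    simp
  rw [h2, ← integral_const_mul, ← integral_const_mul, ← integral_const_mul (c ^ p),
    ← integral_const_mul, ← integral_add ((hY2.const_mul _).const_mul _)
      ((hYp.const_mul _).const_mul _)]
  refine norm_integral_le_of_norm_le (((hY2.const_mul _).const_mul _).add
      ((hYp.const_mul _).const_mul _)) (Eventually.of_forall fun ω ↦ ?_)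
  refine (norm_exp_mul_I_sub_le hε0 hε1 hp (c * Y ω)).trans (le_of_eq ?_)
  rw [abs_mul, abs_of_nonneg hc, Real.mul_rpow hc (abs_nonneg _), mul_pow]

lemma integral_abs_rpow_le {p : ℝ} (hp : 1 ≤ p) (hY : MemLp Y (ENNReal.ofReal p) P) :
    (∫ ω, |Y ω| ∂P) ^ p ≤ ∫ ω, |Y ω| ^ p ∂P := by
  have hp0 : 0 < p := by linarith
  have hY1 : Integrable Y P := hY.integrable (by
    rw [← ENNReal.ofReal_one]
    exact ENNReal.ofReal_le_ofReal hp)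
  have hYp := integrable_abs_rpow hp0 hY
  exact (convexOn_rpow hp).map_integral_le
    (Real.continuous_rpow_const hp0.le).continuousOn isClosed_Ici
    (Eventually.of_forall fun ω ↦ abs_nonneg (Y ω)) hY1.abs hYp

end Moments

set_option maxHeartbeats 1000000 in
/-- The central limit theorem at the level of generating functions, for real valued weights. -/
lemma tendsto_ewensGen_mul_exp {Ω : Type*} [MeasurableSpace Ω] {P : Measure Ω}
    [IsProbabilityMeasure P] {θ p : ℝ} (hθ : 0 < θ) (hp : max (1 / θ) 2 < p) {V : ℕ → ℝ}
    (hV : Tendsto V atTop atTop) {Y : ℕ → Ω → ℝ}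
    (hY : ∀ m, 1 ≤ m → MemLp (Y m) (ENNReal.ofReal p) P) {v : ℝ}
    (hv : Tendsto (fun n : ℕ ↦ (∑ m ∈ Finset.Icc 1 n, (1 / (m : ℝ)) * ∫ ω, Y m ω ^ 2 ∂P) / V n)
      atTop (𝓝 v))
    (hmom : (fun n : ℕ ↦ ∑ m ∈ Finset.Icc 1 n, (1 / (m : ℝ)) * ∫ ω, |Y m ω| ^ p ∂P)
      =o[atTop] fun n ↦ V n ^ (p / 2)) :
    Tendsto (fun n : ℕ ↦
      ewensGen θ (fun m ↦ ∫ ω, Complex.exp (((√(θ * V n))⁻¹ * Y m ω : ℝ) * Complex.I) ∂P) n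
        * Complex.exp (-(((√(θ * V n))⁻¹ * ∑ m ∈ Finset.Icc 1 n, ewensMean θ n m * ∫ ω, Y m ω ∂P :
          ℝ) * Complex.I)))
      atTop (𝓝 (Complex.exp (-(v / 2 : ℝ)))) := by
  have hp2 : 2 < p := (le_max_right _ _).trans_lt hp
  have hpθ : 1 / θ < p := (le_max_left _ _).trans_lt hp
  have hp0 : 0 < p := by linarith
  have hpα : 1 / p < min θ 1 := by
    refine lt_min ?_ ?_
    · rw [div_lt_iff₀ hθ] at hpθ
      rw [div_lt_iff₀ hp0]
      linarith
    · rw [div_lt_one hp0]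
      linarith
  obtain ⟨K, hK0, hK⟩ := exists_sum_couplingWeight_le (by linarith) hpα
  have hC0 := couplingConst_nonneg hθ
  set C := couplingConst θ
  set c : ℕ → ℝ := fun n ↦ (√(θ * V n))⁻¹ with hc
  set S : ℕ → ℝ := fun n ↦ ∑ m ∈ Finset.Icc 1 n, (1 / (m : ℝ)) * ∫ ω, |Y m ω| ^ p ∂P with hS
  set Q : ℕ → ℝ := fun n ↦ ∑ m ∈ Finset.Icc 1 n, (1 / (m : ℝ)) * ∫ ω, Y m ω ^ 2 ∂P with hQ
  set ψ : ℕ → ℕ → ℂ := fun n m ↦ ∫ ω, Complex.exp ((c n * Y m ω : ℝ) * Complex.I) ∂P with hψ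
  set κ : ℕ → ℝ := fun n ↦ c n * ∑ m ∈ Finset.Icc 1 n, ewensMean θ n m * ∫ ω, Y m ω ∂P with hκ
  set L : ℕ → ℂ := fun n ↦ ∑ m ∈ Finset.Icc 1 n, θ / m * (ψ n m - 1) with hL
  have hc0 : ∀ n, 0 ≤ c n := fun n ↦ by positivity
  have hS0 : ∀ n, 0 ≤ S n := fun n ↦ Finset.sum_nonneg fun m _ ↦
    mul_nonneg (by positivity) (integral_nonneg fun ω ↦ by positivity)
  have hY1 : ∀ m, 1 ≤ m → Integrable (Y m) P := fun m hm ↦ (hY m hm).integrable (by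
    rw [← ENNReal.ofReal_one]
    exact ENNReal.ofReal_le_ofReal (by linarith))
  have hR : Tendsto (fun n ↦ S n / V n ^ (p / 2)) atTop (𝓝 0) := hmom.tendsto_div_nhds_zero
  have hcp : Tendsto (fun n ↦ c n ^ p * S n) atTop (𝓝 0) := by
    have h1 := hR.const_mul ((θ ^ (p / 2))⁻¹)
    rw [mul_zero] at h1
    refine h1.congr' ?_
    filter_upwards [hV.eventually_gt_atTop 0] with n hn
    rw [hc]
    simp only
    rw [Real.inv_rpow (Real.sqrt_nonneg _), Real.sqrt_eq_rpow, ← Real.rpow_mul (by positivity),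
      Real.mul_rpow hθ.le hn.le, show 1 / 2 * p = p / 2 by ring, mul_inv]
    ring
  have hc1 : Tendsto (fun n ↦ c n * S n ^ (1 / p)) atTop (𝓝 0) := by
    have h1 := (Real.continuous_rpow_const (by positivity : 0 ≤ 1 / p)).tendsto 0 |>.comp hcp
    rw [Real.zero_rpow (by positivity)] at h1
    refine h1.congr fun n ↦ ?_
    rw [Function.comp_apply, Real.mul_rpow (by have := hc0 n; positivity) (hS0 n),
      ← Real.rpow_mul (hc0 n), mul_one_div_cancel hp0.ne', Real.rpow_one]
  have ha : ∀ n, 1 ≤ n → ∑ m ∈ Finset.Icc 1 n, couplingWeight θ n m * ∫ ω, |Y m ω| ∂P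
      ≤ K * S n ^ (1 / p) := fun n hn ↦ by
    refine (hK n _ hn fun m ↦ integral_nonneg fun ω ↦ abs_nonneg _).trans ?_
    refine mul_le_mul_of_nonneg_left (Real.rpow_le_rpow (Finset.sum_nonneg fun m _ ↦ ?_)
      (Finset.sum_le_sum fun m hm ↦ ?_) (by positivity)) hK0
    · have : 0 ≤ ∫ ω, |Y m ω| ∂P := integral_nonneg fun ω ↦ abs_nonneg _
      positivity
    · exact mul_le_mul_of_nonneg_left
        (integral_abs_rpow_le (by linarith) (hY m (Finset.mem_Icc.1 hm).1)) (by positivity)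
  have hG : ∀ n, 1 ≤ n → ‖ewensGen θ (ψ n) n - Complex.exp (L n)‖
      ≤ C * K * (c n * S n ^ (1 / p)) := fun n hn ↦ by
    refine (norm_ewensGen_sub_exp_le hθ (fun m ↦ norm_integral_exp_mul_I_le_one _) hn).trans ?_
    have h1 : ∑ m ∈ Finset.Icc 1 n, couplingWeight θ n m * ‖ψ n m - 1‖
        ≤ c n * ∑ m ∈ Finset.Icc 1 n, couplingWeight θ n m * ∫ ω, |Y m ω| ∂P := by
      rw [Finset.mul_sum]
      refine Finset.sum_le_sum fun m hm ↦ ?_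
      rw [mul_left_comm]
      exact mul_le_mul_of_nonneg_left (norm_integral_exp_mul_I_sub_one_le
        (hY1 m (Finset.mem_Icc.1 hm).1) (hc0 n)) (couplingWeight_nonneg θ n m)
    calc _ ≤ C * (c n * (K * S n ^ (1 / p))) := mul_le_mul_of_nonneg_left
          (h1.trans (mul_le_mul_of_nonneg_left (ha n hn) (hc0 n))) hC0
      _ = _ := by ring
  have hE : ∀ ε : ℝ, 0 < ε → ε ≤ 1 → ∀ n, 1 ≤ n → 0 < V n →
      ‖L n - κ n * Complex.I + (Q n / V n / 2 : ℝ)‖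
        ≤ ε * (Q n / V n) + 4 * θ * ε ^ (2 - p) * (c n ^ p * S n)
          + C * K * (c n * S n ^ (1 / p)) := by
    intro ε hε0 hε1 n hn hVn
    have hc2 : Q n / V n = θ * c n ^ 2 * Q n := by
      simp only [hc]
      rw [inv_pow, Real.sq_sqrt (by positivity)]
      field_simp
    -- The Taylor expansion is centred at `θ / m`, whereas the true centring uses the mean cycle
    -- count; the last sum is the discrepancy.
    have e1 : L n - κ n * Complex.I + (Q n / V n / 2 : ℝ)
        = (∑ m ∈ Finset.Icc 1 n, (θ / m : ℂ) * (ψ n m - 1 - (c n * ∫ ω, Y m ω ∂P : ℝ) * Complex.I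
            + (c n ^ 2 * (∫ ω, Y m ω ^ 2 ∂P) / 2 : ℝ)))
          - ∑ m ∈ Finset.Icc 1 n, ((c n * ((ewensMean θ n m - θ / m) * ∫ ω, Y m ω ∂P) : ℝ) : ℂ)
            * Complex.I := by
      rw [hc2]
      simp only [hL, hκ, hQ]
      push_cast
      rw [Finset.mul_sum, Finset.mul_sum, Finset.sum_mul, Finset.sum_div,
        ← Finset.sum_sub_distrib, ← Finset.sum_add_distrib, ← Finset.sum_sub_distrib]
      refine Finset.sum_congr rfl fun m _ ↦ ?_
      ring
    rw [e1]
    refine (norm_sub_le _ _).trans (add_le_add ?_ ?_)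
    · rw [hc2]
      simp only [hQ, hS]
      rw [Finset.mul_sum, Finset.mul_sum, Finset.mul_sum, Finset.mul_sum,
        ← Finset.sum_add_distrib]
      refine norm_sum_le_of_le _ fun m hm ↦ ?_
      have h1 := norm_integral_exp_mul_I_sub_le hp2.le (hY m (Finset.mem_Icc.1 hm).1) (hc0 n)
        hε0 hε1
      have h2 : ‖(θ / m : ℂ)‖ = θ / m := by
        rw [norm_div, Complex.norm_real, Complex.norm_natCast, Real.norm_of_nonneg hθ.le]
      rw [norm_mul, h2]
      refine (mul_le_mul_of_nonneg_left h1 (by positivity)).trans (le_of_eq ?_)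
      ring
    · have h1 : ‖∑ m ∈ Finset.Icc 1 n,
          ((c n * ((ewensMean θ n m - θ / m) * ∫ ω, Y m ω ∂P) : ℝ) : ℂ) * Complex.I‖
          ≤ C * (c n * ∑ m ∈ Finset.Icc 1 n, couplingWeight θ n m * ∫ ω, |Y m ω| ∂P) := by
        rw [Finset.mul_sum, Finset.mul_sum]
        refine norm_sum_le_of_le _ fun m hm ↦ ?_
        obtain ⟨hm1, hm2⟩ := Finset.mem_Icc.1 hm
        rw [norm_mul, Complex.norm_I, mul_one, Complex.norm_real, Real.norm_eq_abs, abs_mul,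
          abs_mul, abs_of_nonneg (hc0 n)]
        have h2 := mul_le_mul (abs_ewensMean_sub_le hθ hm1 hm2) (abs_integral_le_integral_abs
          (f := Y m) (μ := P)) (abs_nonneg _) (mul_nonneg hC0 (couplingWeight_nonneg θ n m))
        refine (mul_le_mul_of_nonneg_left h2 (hc0 n)).trans (le_of_eq ?_)
        ring
      refine h1.trans ?_
      calc _ ≤ C * (c n * (K * S n ^ (1 / p))) :=
            mul_le_mul_of_nonneg_left (mul_le_mul_of_nonneg_left (ha n hn) (hc0 n)) hC0
        _ = _ := by ring
  have hE0 : Tendsto (fun n ↦ L n - κ n * Complex.I + (Q n / V n / 2 : ℝ)) atTop (𝓝 0) := by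
    rw [Metric.tendsto_nhds]
    intro δ hδ
    simp only [dist_zero_right]
    -- Eventually `Q n / V n ≤ |v| + 1`, so the variance term costs at most `δ / 2`.
    set ε : ℝ := min 1 (δ / (2 * (|v| + 1)))
    have hv0 : 0 < |v| + 1 := by positivity
    have hε0 : 0 < ε := lt_min one_pos (by positivity)
    have hεv : ε * (|v| + 1) ≤ δ / 2 := by
      calc ε * (|v| + 1) ≤ δ / (2 * (|v| + 1)) * (|v| + 1) :=
            mul_le_mul_of_nonneg_right (min_le_right _ _) hv0.le
        _ = δ / 2 := by field_simp
    have h1 : Tendsto (fun n ↦ 4 * θ * ε ^ (2 - p) * (c n ^ p * S n)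
        + C * K * (c n * S n ^ (1 / p))) atTop (𝓝 0) := by
      simpa using (hcp.const_mul (4 * θ * ε ^ (2 - p))).add (hc1.const_mul (C * K))
    filter_upwards [eventually_ge_atTop 1, hV.eventually_gt_atTop 0,
      h1.eventually_lt_const (half_pos hδ),
      hv.eventually_le_const (show v < |v| + 1 by linarith [le_abs_self v])] with n hn hVn h2 h3
    have h4 := hE ε hε0 (min_le_left _ _) n hn hVn
    change Q n / V n ≤ |v| + 1 at h3
    have h5 := mul_le_mul_of_nonneg_left h3 hε0.le
    linarith
  have hexp : Tendsto (fun n ↦ Complex.exp (L n - κ n * Complex.I)) atTop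
      (𝓝 (Complex.exp (-(v / 2 : ℝ)))) := by
    have h1 : Tendsto (fun n ↦ ((Q n / V n / 2 : ℝ) : ℂ)) atTop (𝓝 ((v / 2 : ℝ) : ℂ)) :=
      (Complex.continuous_ofReal.tendsto _).comp (hv.div_const 2)
    have h2 := (hE0.sub h1).cexp
    simp only [add_sub_cancel_right, zero_sub] at h2
    exact h2
  have hdiff : Tendsto (fun n ↦ ewensGen θ (ψ n) n * Complex.exp (-(κ n * Complex.I))
      - Complex.exp (L n - κ n * Complex.I)) atTop (𝓝 0) := by
    refine squeeze_zero_norm' (a := fun n ↦ C * K * (c n * S n ^ (1 / p))) ?_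
      (by simpa using hc1.const_mul (C * K))
    filter_upwards [eventually_ge_atTop 1] with n hn
    have h1 : ‖Complex.exp (-(κ n * Complex.I))‖ = 1 := by
      rw [← neg_mul, ← Complex.ofReal_neg, Complex.norm_exp_ofReal_mul_I]
    rw [sub_eq_add_neg (L n), Complex.exp_add, ← sub_mul, norm_mul, h1, mul_one]
    exact hG n hn
  have h := hdiff.add hexp
  simp only [sub_add_cancel, zero_add] at h
  exact h

end EwensCLT

namespace EwensCLT

/-! ### The characteristic function and the mean of the cycle sum -/

lemma ewensWeight_nonneg {θ : ℝ} (hθ : 0 < θ) {n : ℕ} (s : Equiv.Perm (Fin n)) :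
    0 ≤ ewensWeight θ s :=
  div_nonneg (by positivity) (Finset.prod_nonneg fun _ _ ↦ by positivity)

lemma prod_pow_cycleCount {n : ℕ} (s : Equiv.Perm (Fin n)) (x : ℕ → ℂ) :
    ∏ m ∈ Finset.Icc 1 n, x m ^ cycleCount m s = (s.partition.parts.map x).prod := by
  rw [Finset.prod_multiset_map_count]
  refine (Finset.prod_subset (fun i hi ↦ ?_) fun i _ hi ↦ ?_).symm
  · have hi' := Multiset.mem_toFinset.1 hi
    refine Finset.mem_Icc.2 ⟨s.partition.parts_pos hi', ?_⟩
    simpa using s.partition.le_of_mem_parts hi'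
  · rw [cycleCount, Multiset.count_eq_zero_of_notMem (by simpa using hi), pow_zero]

lemma sum_ewensWeight_mul_prod {θ : ℝ} {n : ℕ} (ψ : ℕ → ℂ) :
    ∑ s : Equiv.Perm (Fin n),
      (ewensWeight θ s : ℂ) * ∏ m ∈ Finset.Icc 1 n, ψ m ^ cycleCount m s = ewensGen θ ψ n := by
  have h : ∀ s : Equiv.Perm (Fin n),
      (ewensWeight θ s : ℂ) * ∏ m ∈ Finset.Icc 1 n, ψ m ^ cycleCount m s
      = (s.partition.parts.map fun m ↦ (θ : ℂ) * ψ m).prod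
        / ((∏ i ∈ Finset.range n, (θ + i) : ℝ) : ℂ) := fun s ↦ by
    rw [prod_pow_cycleCount, Multiset.prod_map_mul, ewensWeight, totalCycles]
    simp only [Multiset.map_const', Multiset.prod_replicate]
    push_cast
    ring
  simp_rw [h]
  rw [← Finset.sum_div,
    sum_perm_eq_cycleAverage n fun s ↦ (s.map fun m ↦ (θ : ℂ) * ψ m).prod, ewensGen, cyclePoly,
    risingCoeff]
  push_cast
  rw [div_div_eq_mul_div, mul_comm]

/-- One factor `θ` is assigned to a marked cycle of length `m`; removing that cycle leaves the
constant weight `θ` on `n - m` points. -/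
lemma sum_ewensWeight_mul_cycleCount {θ : ℝ} {n m : ℕ} (hm : 1 ≤ m) (hmn : m ≤ n) :
    ∑ s : Equiv.Perm (Fin n), (ewensWeight θ s : ℂ) * (cycleCount m s : ℂ)
      = (ewensMean θ n m : ℂ) := by
  have h : ∀ s : Equiv.Perm (Fin n), (ewensWeight θ s : ℂ) * (cycleCount m s : ℂ)
      = (s.partition.parts.count m
          * (θ * ((s.partition.parts.erase m).map fun _ ↦ (θ : ℂ)).prod))
        / ((∏ i ∈ Finset.range n, (θ + i) : ℝ) : ℂ) := fun s ↦ by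
    rw [ewensWeight, totalCycles, cycleCount]
    by_cases hs : m ∈ s.partition.parts
    · rw [← Multiset.card_erase_add_one hs]
      simp only [Multiset.map_const', Multiset.prod_replicate]
      push_cast
      ring
    · rw [Multiset.count_eq_zero_of_notMem hs]
      simp
  simp_rw [h]
  rw [← Finset.sum_div, sum_perm_eq_cycleAverage n fun s ↦ s.count m
      * (θ * ((s.erase m).map fun _ ↦ (θ : ℂ)).prod),
    cycleAverage_count_mul hm hmn fun s ↦ θ * (s.map fun _ ↦ (θ : ℂ)).prod, cycleAverage_mul_left,
    ← cyclePoly, cyclePoly_const, ewensMean, risingCoeff, risingCoeff]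
  push_cast
  rw [div_div_eq_mul_div]
  ring

/-- The sum over the cycles of a fixed permutation, as a function of the family of vectors. -/
def familySum {E : Type*} [AddCommMonoid E] {n : ℕ} (s : Equiv.Perm (Fin n))
    (x : ℕ+ × ℕ+ → E) : E :=
  ∑ m ∈ Finset.Icc 1 n, ∑ k ∈ Finset.Icc 1 (cycleCount m s), x (m.toPNat', k.toPNat')

lemma toPNat'_coe_of_mem_Icc {m n : ℕ} (hm : m ∈ Finset.Icc 1 n) : (m.toPNat' : ℕ) = m := by
  rw [Nat.toPNat'_coe, if_pos (Nat.lt_of_succ_le (Finset.mem_Icc.1 hm).1)]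

lemma familySum_eq_cycleSum {Ω : Type*} {d n : ℕ} {X : ℕ → ℕ → Ω → EuclideanSpace ℝ (Fin d)}
    (τ : Ω → Equiv.Perm (Fin n)) (ω : Ω) :
    familySum (τ ω) (fun q : ℕ+ × ℕ+ ↦ X q.1 q.2 ω) = cycleSum τ X ω := by
  refine Finset.sum_congr rfl fun m hm ↦ Finset.sum_congr rfl fun k hk ↦ ?_
  simp only [toPNat'_coe_of_mem_Icc hm, toPNat'_coe_of_mem_Icc hk]

section Probability

variable {Ω : Type*} [MeasurableSpace Ω] {P : Measure Ω}

lemma measurableSet_preimage_perm {n : ℕ} {τ : Ω → Equiv.Perm (Fin n)} (hτ : Measurable τ)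
    (s : Equiv.Perm (Fin n)) : MeasurableSet (τ ⁻¹' {s}) :=
  hτ MeasurableSpace.measurableSet_top

/-- Conditioning on the permutation, done by splitting over its finitely many values. -/
lemma integral_comp_ewens {𝓧 : Type*} [MeasurableSpace 𝓧] {θ : ℝ} (hθ : 0 < θ) {n : ℕ}
    {τ : Ω → Equiv.Perm (Fin n)} (hτ : IsEwens P θ τ) {Z : Ω → 𝓧} (hZ : Measurable Z)
    (hind : IndepFun τ Z P) {F : Equiv.Perm (Fin n) → 𝓧 → ℂ} (hF : ∀ s, Measurable (F s))
    (hFi : ∀ s, Integrable (fun ω ↦ F s (Z ω)) P) :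
    ∫ ω, F (τ ω) (Z ω) ∂P = ∑ s, (ewensWeight θ s : ℂ) * ∫ ω, F s (Z ω) ∂P := by
  classical
  have h1 : ∀ ω, F (τ ω) (Z ω)
      = ∑ s, (if τ ω = s then (1 : ℂ) else 0) * F s (Z ω) := fun ω ↦ by simp
  have h2 : ∀ s, Integrable (fun ω ↦ (if τ ω = s then (1 : ℂ) else 0) * F s (Z ω)) P := fun s ↦ by
    refine ((hFi s).indicator (measurableSet_preimage_perm hτ.measurable s)).congr
      (Eventually.of_forall fun ω ↦ ?_)
    by_cases h : τ ω = s <;> simp [Set.indicator, h]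
  simp_rw [h1]
  rw [integral_finsetSum _ fun s _ ↦ h2 s]
  refine Finset.sum_congr rfl fun s _ ↦ ?_
  have h3 : Measurable fun x : Equiv.Perm (Fin n) ↦ if x = s then (1 : ℂ) else 0 :=
    fun _ _ ↦ MeasurableSpace.measurableSet_top
  rw [hind.integral_fun_comp_mul_comp (f := fun x ↦ if x = s then (1 : ℂ) else 0) (g := F s)
    hτ.measurable.aemeasurable hZ.aemeasurable h3.aestronglyMeasurable
    (hF s).aestronglyMeasurable]
  congr 1
  have h4 : (fun ω ↦ if τ ω = s then (1 : ℂ) else 0)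
      = (τ ⁻¹' {s}).indicator fun _ ↦ (1 : ℂ) := by
    ext ω
    by_cases h : τ ω = s <;> simp [Set.indicator, h]
  rw [h4, integral_indicator_const _ (measurableSet_preimage_perm hτ.measurable s), measureReal_def,
    hτ.prob_eq, ENNReal.toReal_ofReal (ewensWeight_nonneg hθ s)]
  simp

variable {d : ℕ} {X : ℕ → ℕ → Ω → EuclideanSpace ℝ (Fin d)}

lemma measurable_familySum {n : ℕ} (s : Equiv.Perm (Fin n)) :
    Measurable (familySum (E := EuclideanSpace ℝ (Fin d)) s) :=
  Finset.measurable_fun_sum _ fun _ _ ↦ Finset.measurable_fun_sum _ fun _ _ ↦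
    measurable_pi_apply _

lemma integral_exp_inner_familySum (t : EuclideanSpace ℝ (Fin d))
    (hX_meas : ∀ m k : ℕ, 1 ≤ m → 1 ≤ k → Measurable (X m k))
    (hX_indep : iIndepFun (fun (q : ℕ+ × ℕ+) ω ↦ X q.1 q.2 ω) P)
    (hX_ident : ∀ m k : ℕ, 1 ≤ m → 1 ≤ k → IdentDistrib (X m k) (X m 1) P P)
    {n : ℕ} (s : Equiv.Perm (Fin n)) :
    ∫ ω, Complex.exp ((inner ℝ t (familySum s fun q : ℕ+ × ℕ+ ↦ X q.1 q.2 ω) : ℝ) * Complex.I) ∂P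
      = ∏ m ∈ Finset.Icc 1 n,
        (∫ ω, Complex.exp ((inner ℝ t (X m 1 ω) : ℝ) * Complex.I) ∂P) ^ cycleCount m s := by
  set T : Finset (Σ _ : ℕ, ℕ) :=
    (Finset.Icc 1 n).sigma fun m ↦ Finset.Icc 1 (cycleCount m s) with hT
  set e : EuclideanSpace ℝ (Fin d) → ℂ := fun x ↦ Complex.exp ((inner ℝ t x : ℝ) * Complex.I)
    with he
  have hem : Measurable e := by
    have : Continuous e := by fun_prop
    exact this.measurable
  -- Independence is indexed by `ℕ+ × ℕ+`, the sum by naturals. `toPNat'` sends `0` to `1`, so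
  -- injectivity relies on all indices being at least `1`.
  have hinj : Function.Injective fun i : T ↦ (i.1.1.toPNat', i.1.2.toPNat') := by
    rintro ⟨⟨a, b⟩, h1⟩ ⟨⟨a', b'⟩, h2⟩ h
    obtain ⟨h1a, h1b⟩ := Finset.mem_sigma.1 h1
    obtain ⟨h2a, h2b⟩ := Finset.mem_sigma.1 h2
    have e1 := congrArg PNat.val (congrArg Prod.fst h)
    have e2 := congrArg PNat.val (congrArg Prod.snd h)
    have e3 : a = a' :=
      (toPNat'_coe_of_mem_Icc h1a).symm.trans (e1.trans (toPNat'_coe_of_mem_Icc h2a))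
    have e4 : b = b' :=
      (toPNat'_coe_of_mem_Icc h1b).symm.trans (e2.trans (toPNat'_coe_of_mem_Icc h2b))
    subst e3 e4
    rfl
  have h1 : ∀ ω, Complex.exp
      ((inner ℝ t (familySum s fun q : ℕ+ × ℕ+ ↦ X q.1 q.2 ω) : ℝ) * Complex.I)
      = ∏ i : T, e (X i.1.1.toPNat' i.1.2.toPNat' ω) := fun ω ↦ by
    rw [Finset.prod_coe_sort T fun i ↦ e (X i.1.toPNat' i.2.toPNat' ω), hT, Finset.prod_sigma]
    simp only [familySum, inner_sum, Complex.ofReal_sum, Finset.sum_mul, Complex.exp_sum, he]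
  have hmeas : ∀ q : ℕ+ × ℕ+, Measurable (X q.1 q.2) := fun q ↦ hX_meas _ _ q.1.2 q.2.2
  have h2 := ((hX_indep.precomp hinj).comp (fun _ ↦ e) fun _ ↦ hem).integral_fun_prod_eq_prod_integral
    fun i ↦ (hem.comp (hmeas (i.1.1.toPNat', i.1.2.toPNat'))).aestronglyMeasurable
  simp_rw [h1]
  refine h2.trans ?_
  have h3 := Finset.prod_coe_sort T fun i ↦ ∫ ω, e (X i.1.toPNat' i.2.toPNat' ω) ∂P
  refine h3.trans ?_
  rw [hT, Finset.prod_sigma]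
  refine Finset.prod_congr rfl fun m hm ↦ ?_
  rw [Finset.prod_congr rfl (g := fun _ ↦ ∫ ω, e (X m 1 ω) ∂P), Finset.prod_const, Nat.card_Icc,
    Nat.add_sub_cancel]
  intro k hk
  simp only [toPNat'_coe_of_mem_Icc hm, toPNat'_coe_of_mem_Icc hk]
  exact ((hX_ident m k (Finset.mem_Icc.1 hm).1 (Finset.mem_Icc.1 hk).1).comp hem).integral_eq

lemma integrable_vector
    (hX_ident : ∀ m k : ℕ, 1 ≤ m → 1 ≤ k → IdentDistrib (X m k) (X m 1) P P)
    (hX_int : ∀ m, 1 ≤ m → Integrable (X m 1) P) {m k : ℕ} (hm : 1 ≤ m) (hk : 1 ≤ k) :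
    Integrable (X m k) P :=
  (hX_ident m k hm hk).integrable_iff.2 (hX_int m hm)

lemma integrable_familySum
    (hX_ident : ∀ m k : ℕ, 1 ≤ m → 1 ≤ k → IdentDistrib (X m k) (X m 1) P P)
    (hX_int : ∀ m, 1 ≤ m → Integrable (X m 1) P) {n : ℕ} (s : Equiv.Perm (Fin n)) :
    Integrable (fun ω ↦ familySum s fun q : ℕ+ × ℕ+ ↦ X q.1 q.2 ω) P :=
  integrable_finsetSum _ fun _ _ ↦ integrable_finsetSum _ fun _ _ ↦
    integrable_vector hX_ident hX_int (PNat.pos _) (PNat.pos _)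

lemma integral_inner_familySum (t : EuclideanSpace ℝ (Fin d))
    (hX_ident : ∀ m k : ℕ, 1 ≤ m → 1 ≤ k → IdentDistrib (X m k) (X m 1) P P)
    (hX_int : ∀ m, 1 ≤ m → Integrable (X m 1) P) {n : ℕ} (s : Equiv.Perm (Fin n)) :
    ∫ ω, inner ℝ t (familySum s fun q : ℕ+ × ℕ+ ↦ X q.1 q.2 ω) ∂P
      = ∑ m ∈ Finset.Icc 1 n, cycleCount m s * ∫ ω, inner ℝ t (X m 1 ω) ∂P := by
  rw [integral_inner (integrable_familySum hX_ident hX_int s)]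
  simp only [familySum]
  rw [integral_finsetSum _ fun m _ ↦ integrable_finsetSum _ fun k _ ↦
    integrable_vector hX_ident hX_int (PNat.pos _) (PNat.pos _), inner_sum]
  refine Finset.sum_congr rfl fun m hm ↦ ?_
  rw [integral_finsetSum _ fun k _ ↦
    integrable_vector hX_ident hX_int (PNat.pos _) (PNat.pos _), inner_sum,
    integral_inner (hX_int m (Finset.mem_Icc.1 hm).1),
    Finset.sum_congr rfl (g := fun _ ↦ inner ℝ t (∫ ω, X m 1 ω ∂P)), Finset.sum_const,
    Nat.card_Icc, Nat.add_sub_cancel, nsmul_eq_mul]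
  intro k hk
  simp only [toPNat'_coe_of_mem_Icc hm, toPNat'_coe_of_mem_Icc hk]
  rw [(hX_ident m k (Finset.mem_Icc.1 hm).1 (Finset.mem_Icc.1 hk).1).integral_eq]

lemma integrable_cycleSum
    (hX_ident : ∀ m k : ℕ, 1 ≤ m → 1 ≤ k → IdentDistrib (X m k) (X m 1) P P)
    (hX_int : ∀ m, 1 ≤ m → Integrable (X m 1) P) {n : ℕ} {τ : Ω → Equiv.Perm (Fin n)}
    (hτ : Measurable τ) : Integrable (cycleSum τ X) P := by
  classical
  have h1 : cycleSum τ X = fun ω ↦ ∑ s, (τ ⁻¹' {s}).indicator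
      (fun ω ↦ familySum s fun q : ℕ+ × ℕ+ ↦ X q.1 q.2 ω) ω := by
    ext1 ω
    rw [← familySum_eq_cycleSum, Finset.sum_eq_single (τ ω)]
    · simp
    · intro s _ hs
      exact Set.indicator_of_notMem (fun h ↦ hs h.symm) _
    · simp
  rw [h1]
  exact integrable_finsetSum _ fun s _ ↦ (integrable_familySum hX_ident hX_int s).indicator
    (measurableSet_preimage_perm hτ s)

lemma measurable_family (hX_meas : ∀ m k : ℕ, 1 ≤ m → 1 ≤ k → Measurable (X m k)) :
    Measurable fun ω (q : ℕ+ × ℕ+) ↦ X q.1 q.2 ω :=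
  measurable_pi_lambda _ fun q ↦ hX_meas _ _ q.1.2 q.2.2

lemma integral_exp_inner_cycleSum [IsProbabilityMeasure P] {θ : ℝ} (hθ : 0 < θ) (t : EuclideanSpace ℝ (Fin d))
    (hX_meas : ∀ m k : ℕ, 1 ≤ m → 1 ≤ k → Measurable (X m k))
    (hX_indep : iIndepFun (fun (q : ℕ+ × ℕ+) ω ↦ X q.1 q.2 ω) P)
    (hX_ident : ∀ m k : ℕ, 1 ≤ m → 1 ≤ k → IdentDistrib (X m k) (X m 1) P P)
    {n : ℕ} {τ : Ω → Equiv.Perm (Fin n)} (hτ : IsEwens P θ τ)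
    (hτX : IndepFun τ (fun ω (q : ℕ+ × ℕ+) ↦ X q.1 q.2 ω) P) :
    ∫ ω, Complex.exp ((inner ℝ t (cycleSum τ X ω) : ℝ) * Complex.I) ∂P
      = ewensGen θ (fun m ↦ ∫ ω, Complex.exp ((inner ℝ t (X m 1 ω) : ℝ) * Complex.I) ∂P) n := by
  have hm : ∀ s : Equiv.Perm (Fin n), Measurable fun x : ℕ+ × ℕ+ → EuclideanSpace ℝ (Fin d) ↦
      (inner ℝ t (familySum s x) : ℝ) := fun s ↦
    measurable_const.inner (measurable_familySum s)
  simp_rw [← familySum_eq_cycleSum]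
  rw [integral_comp_ewens hθ hτ (measurable_family hX_meas) hτX
    (F := fun s x ↦ Complex.exp ((inner ℝ t (familySum s x) : ℝ) * Complex.I)),
    ← sum_ewensWeight_mul_prod]
  · refine Finset.sum_congr rfl fun s _ ↦ ?_
    rw [integral_exp_inner_familySum t hX_meas hX_indep hX_ident s]
  · intro s
    exact Complex.measurable_exp.comp ((Complex.measurable_ofReal.comp (hm s)).mul_const _)
  · intro s
    exact integrable_exp_mul_I ((hm s).comp (measurable_family hX_meas)).aestronglyMeasurable

lemma integral_inner_cycleSum {θ : ℝ} (hθ : 0 < θ) (t : EuclideanSpace ℝ (Fin d))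
    (hX_meas : ∀ m k : ℕ, 1 ≤ m → 1 ≤ k → Measurable (X m k))
    (hX_ident : ∀ m k : ℕ, 1 ≤ m → 1 ≤ k → IdentDistrib (X m k) (X m 1) P P)
    (hX_int : ∀ m, 1 ≤ m → Integrable (X m 1) P)
    {n : ℕ} {τ : Ω → Equiv.Perm (Fin n)} (hτ : IsEwens P θ τ)
    (hτX : IndepFun τ (fun ω (q : ℕ+ × ℕ+) ↦ X q.1 q.2 ω) P) :
    ∫ ω, inner ℝ t (cycleSum τ X ω) ∂P
      = ∑ m ∈ Finset.Icc 1 n, ewensMean θ n m * ∫ ω, inner ℝ t (X m 1 ω) ∂P := by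
  have hm : ∀ s : Equiv.Perm (Fin n), Measurable fun x : ℕ+ × ℕ+ → EuclideanSpace ℝ (Fin d) ↦
      (inner ℝ t (familySum s x) : ℝ) := fun s ↦
    measurable_const.inner (measurable_familySum s)
  apply Complex.ofReal_injective
  rw [← integral_complex_ofReal]
  simp_rw [← familySum_eq_cycleSum]
  rw [integral_comp_ewens hθ hτ (measurable_family hX_meas) hτX
    (F := fun s x ↦ ((inner ℝ t (familySum s x) : ℝ) : ℂ))]
  · simp_rw [integral_complex_ofReal, integral_inner_familySum t hX_ident hX_int]
    push_cast
    simp_rw [Finset.mul_sum]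
    rw [Finset.sum_comm]
    refine Finset.sum_congr rfl fun m hm ↦ ?_
    obtain ⟨h1, h2⟩ := Finset.mem_Icc.1 hm
    rw [← sum_ewensWeight_mul_cycleCount h1 h2, Finset.sum_mul]
    exact Finset.sum_congr rfl fun s _ ↦ (mul_assoc _ _ _).symm
  · exact fun s ↦ Complex.measurable_ofReal.comp (hm s)
  · intro s
    exact ((integrable_familySum hX_ident hX_int s).const_inner t).ofReal

end Probability

end EwensCLT

namespace EwensCLT

/-! ### Projections of random vectors -/

section Projection

variable {Ω : Type*} [MeasurableSpace Ω] {P : Measure Ω} {d : ℕ}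

lemma inner_eq_sum (t x : EuclideanSpace ℝ (Fin d)) : inner ℝ t x = ∑ j, t j * x j := by
  rw [PiLp.inner_apply]
  exact Finset.sum_congr rfl fun j _ ↦ by simp [mul_comm]

/-- The power mean inequality; it transfers the coordinatewise moment condition to every projection.
-/
lemma abs_inner_rpow_le {p : ℝ} (hp : 1 ≤ p) (t x : EuclideanSpace ℝ (Fin d)) :
    |(inner ℝ t x : ℝ)| ^ p
      ≤ (d : ℝ) ^ (p - 1) * ∑ j, |t j| ^ p * |x j| ^ p := by
  have h := Real.rpow_sum_le_const_mul_sum_rpow Finset.univ (fun j ↦ t j * x j) hp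
  rw [Finset.card_univ, Fintype.card_fin] at h
  simp_rw [abs_mul, fun j ↦ Real.mul_rpow (abs_nonneg (t j)) (abs_nonneg (x j)) (z := p)] at h
  refine le_trans (Real.rpow_le_rpow (abs_nonneg _) ?_ (by linarith)) h
  rw [inner_eq_sum]
  refine (Finset.abs_sum_le_sum_abs _ _).trans (le_of_eq ?_)
  exact Finset.sum_congr rfl fun j _ ↦ abs_mul _ _

lemma memLp_inner {Z : Ω → EuclideanSpace ℝ (Fin d)} {q : ENNReal}
    (hZ : ∀ j, MemLp (fun ω ↦ Z ω j) q P) (t : EuclideanSpace ℝ (Fin d)) :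
    MemLp (fun ω ↦ (inner ℝ t (Z ω) : ℝ)) q P := by
  simp_rw [inner_eq_sum]
  exact memLp_finsetSum _ fun j _ ↦ (hZ j).const_mul (t j)

lemma integral_inner_sq {Z : Ω → EuclideanSpace ℝ (Fin d)}
    (hZ : ∀ j, MemLp (fun ω ↦ Z ω j) 2 P) (t : EuclideanSpace ℝ (Fin d)) :
    ∫ ω, (inner ℝ t (Z ω) : ℝ) ^ 2 ∂P = ∑ j, ∑ l, t j * t l * ∫ ω, Z ω j * Z ω l ∂P := by
  have h1 : ∀ j l, Integrable (fun ω ↦ Z ω j * Z ω l) P := fun j l ↦ (hZ j).integrable_mul (hZ l)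
  have h2 : ∀ ω, (inner ℝ t (Z ω) : ℝ) ^ 2 = ∑ j, ∑ l, t j * t l * (Z ω j * Z ω l) := fun ω ↦ by
    rw [inner_eq_sum, sq, Finset.sum_mul_sum]
    exact Finset.sum_congr rfl fun j _ ↦ Finset.sum_congr rfl fun l _ ↦ by ring
  simp_rw [h2]
  rw [integral_finsetSum _ fun j _ ↦ integrable_finsetSum _ fun l _ ↦ (h1 j l).const_mul _]
  refine Finset.sum_congr rfl fun j _ ↦ ?_
  rw [integral_finsetSum _ fun l _ ↦ (h1 j l).const_mul _]
  exact Finset.sum_congr rfl fun l _ ↦ integral_const_mul _ _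

lemma integral_abs_inner_rpow_le {p : ℝ} (hp : 1 ≤ p) {Z : Ω → EuclideanSpace ℝ (Fin d)}
    (hZ : ∀ j, MemLp (fun ω ↦ Z ω j) (ENNReal.ofReal p) P) (t : EuclideanSpace ℝ (Fin d)) :
    ∫ ω, |(inner ℝ t (Z ω) : ℝ)| ^ p ∂P
      ≤ (d : ℝ) ^ (p - 1) * ∑ j, |t j| ^ p * ∫ ω, |Z ω j| ^ p ∂P := by
  have h1 : ∀ j, Integrable (fun ω ↦ |t j| ^ p * |Z ω j| ^ p) P := fun j ↦
    (integrable_abs_rpow (by linarith) (hZ j)).const_mul _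
  refine (integral_mono (integrable_abs_rpow (by linarith) (memLp_inner hZ t))
    ((integrable_finsetSum _ fun j _ ↦ h1 j).const_mul _)
    fun ω ↦ abs_inner_rpow_le hp t (Z ω)).trans (le_of_eq ?_)
  rw [integral_const_mul, integral_finsetSum _ fun j _ ↦ h1 j]
  simp_rw [integral_const_mul]

variable {p : ℝ} {Z : ℕ → Ω → EuclideanSpace ℝ (Fin d)} {V : ℕ → ℝ}

lemma isLittleO_sum_integral_abs_inner_rpow (hp : 1 ≤ p)
    (hZ : ∀ m, 1 ≤ m → ∀ j, MemLp (fun ω ↦ Z m ω j) (ENNReal.ofReal p) P)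
    (hmom : ∀ j, (fun n : ℕ ↦ ∑ m ∈ Finset.Icc 1 n, (1 / (m : ℝ)) * ∫ ω, |Z m ω j| ^ p ∂P)
      =o[atTop] fun n ↦ V n ^ (p / 2)) (t : EuclideanSpace ℝ (Fin d)) :
    (fun n : ℕ ↦ ∑ m ∈ Finset.Icc 1 n,
      (1 / (m : ℝ)) * ∫ ω, |(inner ℝ t (Z m ω) : ℝ)| ^ p ∂P) =o[atTop] fun n ↦ V n ^ (p / 2) := by
  have h1 : (fun n : ℕ ↦ (d : ℝ) ^ (p - 1) * ∑ j, |t j| ^ p * ∑ m ∈ Finset.Icc 1 n,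
      (1 / (m : ℝ)) * ∫ ω, |Z m ω j| ^ p ∂P) =o[atTop] fun n ↦ V n ^ (p / 2) :=
    (IsLittleO.fun_sum fun j _ ↦ (hmom j).const_mul_left _).const_mul_left _
  refine (IsBigO.of_bound 1 (Eventually.of_forall fun n ↦ ?_)).trans_isLittleO h1
  rw [one_mul, Real.norm_of_nonneg (Finset.sum_nonneg fun m _ ↦
    mul_nonneg (by positivity) (integral_nonneg fun ω ↦ by positivity))]
  refine le_trans ?_ (Real.le_norm_self _)
  simp_rw [Finset.mul_sum]
  rw [Finset.sum_comm]
  refine Finset.sum_le_sum fun m hm ↦ ?_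
  refine (mul_le_mul_of_nonneg_left
    (integral_abs_inner_rpow_le hp (hZ m (Finset.mem_Icc.1 hm).1) t) (by positivity)).trans
    (le_of_eq ?_)
  rw [Finset.mul_sum, Finset.mul_sum]
  exact Finset.sum_congr rfl fun j _ ↦ by ring

lemma tendsto_sum_integral_inner_sq
    (hZ : ∀ m, 1 ≤ m → ∀ j, MemLp (fun ω ↦ Z m ω j) 2 P) {S : Matrix (Fin d) (Fin d) ℝ}
    (hS : ∀ j l, Tendsto (fun n : ℕ ↦
      (∑ m ∈ Finset.Icc 1 n, (1 / (m : ℝ)) * ∫ ω, Z m ω j * Z m ω l ∂P) / V n) atTop (𝓝 (S j l)))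
    (t : EuclideanSpace ℝ (Fin d)) :
    Tendsto (fun n : ℕ ↦ (∑ m ∈ Finset.Icc 1 n,
      (1 / (m : ℝ)) * ∫ ω, (inner ℝ t (Z m ω) : ℝ) ^ 2 ∂P) / V n) atTop
      (𝓝 (t.ofLp ⬝ᵥ S.mulVec t.ofLp)) := by
  have h1 : Tendsto (fun n : ℕ ↦ ∑ j, ∑ l, t j * t l *
      ((∑ m ∈ Finset.Icc 1 n, (1 / (m : ℝ)) * ∫ ω, Z m ω j * Z m ω l ∂P) / V n)) atTop
      (𝓝 (∑ j, ∑ l, t j * t l * S j l)) :=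
    tendsto_finsetSum _ fun j _ ↦ tendsto_finsetSum _ fun l _ ↦ (hS j l).const_mul _
  have h2 : ∑ j, ∑ l, t j * t l * S j l = t.ofLp ⬝ᵥ S.mulVec t.ofLp := by
    simp only [dotProduct, Matrix.mulVec, Finset.mul_sum]
    exact Finset.sum_congr rfl fun j _ ↦ Finset.sum_congr rfl fun l _ ↦ by ring
  rw [h2] at h1
  refine h1.congr fun n ↦ ?_
  rw [Finset.sum_congr rfl (fun m hm ↦ by
    rw [integral_inner_sq (hZ m (Finset.mem_Icc.1 hm).1) t] : ∀ m ∈ Finset.Icc 1 n,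
      (1 / (m : ℝ)) * ∫ ω, (inner ℝ t (Z m ω) : ℝ) ^ 2 ∂P
        = (1 / (m : ℝ)) * ∑ j, ∑ l, t j * t l * ∫ ω, Z m ω j * Z m ω l ∂P)]
  have h3 : ∑ m ∈ Finset.Icc 1 n, (1 / (m : ℝ)) * ∑ j, ∑ l, t j * t l * ∫ ω, Z m ω j * Z m ω l ∂P
      = ∑ j, ∑ l, t j * t l
        * ∑ m ∈ Finset.Icc 1 n, (1 / (m : ℝ)) * ∫ ω, Z m ω j * Z m ω l ∂P := by
    simp_rw [Finset.mul_sum]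
    rw [Finset.sum_comm]
    refine Finset.sum_congr rfl fun j _ ↦ ?_
    rw [Finset.sum_comm]
    exact Finset.sum_congr rfl fun l _ ↦ Finset.sum_congr rfl fun m _ ↦ mul_left_comm _ _ _
  rw [h3, Finset.sum_div]
  refine Finset.sum_congr rfl fun j _ ↦ ?_
  rw [Finset.sum_div]
  exact Finset.sum_congr rfl fun l _ ↦ (mul_div_assoc _ _ _).symm

end Projection

end EwensCLT

/-! ### Conclusion by Lévy's continuity theorem. -/

theorem mainTheorem7 {Ω : Type*} [MeasurableSpace Ω] (P : Measure Ω) [IsProbabilityMeasure P]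
    (θ : ℝ) (hθ : 0 < θ) (d : ℕ)
    -- the random vectors, with indices `m ≥ 1` and `k ≥ 1`
    (X : ℕ → ℕ → Ω → EuclideanSpace ℝ (Fin d))
    (hX_meas : ∀ m k : ℕ, 1 ≤ m → 1 ≤ k → Measurable (X m k))
    (hX_indep : iIndepFun (fun (q : ℕ+ × ℕ+) ω ↦ X q.1 q.2 ω) P)
    (hX_ident : ∀ m k : ℕ, 1 ≤ m → 1 ≤ k → IdentDistrib (X m k) (X m 1) P P)
    -- for each `n`, an Ewens permutation of `n` points, independent of the random vectors
    (τ : (n : ℕ) → Ω → Equiv.Perm (Fin n))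
    (hτ : ∀ n, EwensCLT.IsEwens P θ (τ n))
    (hτX : ∀ n, IndepFun (τ n) (fun ω (q : ℕ+ × ℕ+) ↦ X q.1 q.2 ω) P)
    (V : ℕ → ℝ) (hV : Tendsto V atTop atTop)
    (p : ℝ) (hp : max (1 / θ) 2 < p)
    (hX_Lp : ∀ m : ℕ, 1 ≤ m → ∀ j, MemLp (fun ω ↦ X m 1 ω j) (ENNReal.ofReal p) P)
    (S : Matrix (Fin d) (Fin d) ℝ)
    (hS : ∀ j l, Tendsto
      (fun n : ℕ ↦ (∑ m ∈ Finset.Icc 1 n, (1 / (m : ℝ)) * ∫ ω, X m 1 ω j * X m 1 ω l ∂P) / V n)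
      atTop (𝓝 (S j l)))
    (hX_mom : ∀ j,
      (fun n : ℕ ↦ ∑ m ∈ Finset.Icc 1 n, (1 / (m : ℝ)) * ∫ ω, |X m 1 ω j| ^ p ∂P)
        =o[atTop] fun n ↦ V n ^ (p / 2)) :
    S.PosSemidef ∧
    (∀ n, Integrable (EwensCLT.cycleSum (τ n) X) P) ∧
    TendstoInDistribution
      (fun (n : ℕ) ω ↦ (√(θ * V n))⁻¹ •
        (EwensCLT.cycleSum (τ n) X ω - ∫ ω', EwensCLT.cycleSum (τ n) X ω' ∂P))
      atTop id (fun _ ↦ P) (multivariateGaussian 0 S) := by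
  have hp2 : 2 < p := (le_max_right _ _).trans_lt hp
  have hX2 : ∀ m, 1 ≤ m → ∀ j, MemLp (fun ω ↦ X m 1 ω j) 2 P := fun m hm j ↦
    (hX_Lp m hm j).mono_exponent (by
      rw [show (2 : ENNReal) = ENNReal.ofReal 2 by simp]
      exact ENNReal.ofReal_le_ofReal hp2.le)
  have hX_int : ∀ m, 1 ≤ m → Integrable (X m 1) P := fun m hm ↦
    Integrable.of_eval_piLp fun j ↦ (hX2 m hm j).integrable one_le_two
  have hquad := EwensCLT.tendsto_sum_integral_inner_sq (Z := fun m ↦ X m 1) hX2 hS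
  have hSpos : S.PosSemidef := by
    refine Matrix.PosSemidef.of_dotProduct_mulVec_nonneg ?_ fun x ↦ ?_
    · ext j l
      rw [Matrix.conjTranspose_apply, star_trivial]
      refine tendsto_nhds_unique (hS l j) ((hS j l).congr fun n ↦ ?_)
      simp_rw [mul_comm (X _ 1 _ j)]
    · rw [star_trivial]
      -- The quadratic form is a limit of normalised sums of second moments of projections, which
      -- are nonnegative once `V n > 0`.
      refine ge_of_tendsto (hquad (WithLp.toLp 2 x)) ?_
      filter_upwards [hV.eventually_gt_atTop 0] with n hn
      exact div_nonneg (Finset.sum_nonneg fun m _ ↦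
        mul_nonneg (by positivity) (integral_nonneg fun ω ↦ sq_nonneg _)) hn.le
  have hA : ∀ n, Integrable (EwensCLT.cycleSum (τ n) X) P := fun n ↦
    EwensCLT.integrable_cycleSum hX_ident hX_int (hτ n).measurable
  have hAm : ∀ n, AEMeasurable (fun ω ↦ (√(θ * V n))⁻¹ •
      (EwensCLT.cycleSum (τ n) X ω - ∫ ω', EwensCLT.cycleSum (τ n) X ω' ∂P)) P := fun n ↦ by
    have := (hA n).aemeasurable
    fun_prop
  refine ⟨hSpos, hA, hAm, aemeasurable_id, ?_⟩
  refine ProbabilityMeasure.tendsto_iff_tendsto_charFun.2 fun t ↦ ?_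
  have hlim := EwensCLT.tendsto_ewensGen_mul_exp hθ hp hV
    (fun m hm ↦ EwensCLT.memLp_inner (hX_Lp m hm) t) (hquad t)
    (EwensCLT.isLittleO_sum_integral_abs_inner_rpow (Z := fun m ↦ X m 1) (by linarith) hX_Lp
      hX_mom t)
  simp only [ProbabilityMeasure.coe_mk, Measure.map_id]
  rw [charFun_multivariateGaussian hSpos]
  have e1 : Complex.exp (((inner ℝ t (0 : EuclideanSpace ℝ (Fin d)) : ℝ) : ℂ) * Complex.I
        - ((t.ofLp ⬝ᵥ S.mulVec t.ofLp : ℝ) : ℂ) / 2)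
      = Complex.exp (-((t.ofLp ⬝ᵥ S.mulVec t.ofLp / 2 : ℝ) : ℂ)) := by
    rw [inner_zero_right]
    push_cast
    ring_nf
  rw [e1]
  refine hlim.congr fun n ↦ ?_
  rw [charFun_apply, integral_map (hAm n) (by fun_prop)]
  set c := (√(θ * V n))⁻¹
  -- The scaling moves onto `t`, and the centring leaves the integral as a deterministic phase given
  -- by the mean cycle counts.
  have e2 : ∀ ω, Complex.exp (((inner ℝ (c • (EwensCLT.cycleSum (τ n) X ω
        - ∫ ω', EwensCLT.cycleSum (τ n) X ω' ∂P)) t : ℝ) : ℂ) * Complex.I)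
      = Complex.exp (((inner ℝ (c • t) (EwensCLT.cycleSum (τ n) X ω) : ℝ) : ℂ) * Complex.I)
        * Complex.exp (-((c * ∑ m ∈ Finset.Icc 1 n,
          EwensCLT.ewensMean θ n m * ∫ ω, (inner ℝ t (X m 1 ω) : ℝ) ∂P : ℝ) * Complex.I)) := by
    intro ω
    rw [← EwensCLT.integral_inner_cycleSum hθ t hX_meas hX_ident hX_int (hτ n) (hτX n),
      integral_inner (hA n), ← Complex.exp_add, real_inner_comm, inner_smul_right, inner_sub_right,
      real_inner_smul_left]
    congr 1
    push_cast
    ring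
  simp_rw [e2]
  rw [integral_mul_const, EwensCLT.integral_exp_inner_cycleSum hθ (c • t) hX_meas hX_indep
    hX_ident (hτ n) (hτX n)]
  simp_rw [real_inner_smul_left]
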